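/- Let $J=\mathrm{diag}(1,1,-1)$ and $\mathrm{SU}(2,1)=\{g\in \mathrm{SL}_3(\mathbb{C}) : \overline{g}^{t}Jg=J\}$, acting on the complex hyperbolic plane $\mathbf{H}^2_{\mathbb{C}}$, the set of complex lines in $\mathbb{C}^3$ on which the form $|z_1|^2+|z_2|^2-|z_3|^2$ is negative definite. An element of $\mathrm{SU}(2,1)$ is elliptic if it has a fixed point in $\mathbf{H}^2_{\mathbb{C}}$. Let $E$ be a CM field with maximal totally real subfield $k$, ring of integers $R_E$ and a fixed embedding $E\hookrightarrow\mathbb{C}$. Let $A$ be a division algebra with center $E$ and $\dim_E A=9$, with an involution $a\mapsto a^*$ that restricts to complex conjugation on $E$. For each embedding $\sigma:E\to\mathbb{C}$ choose an isomorphism $A\otimes_{E,\sigma}\mathbb{C}\cong \mathrm{M}_3(\mathbb{C})$, inducing $\rho_\sigma:A\to \mathrm{M}_3(\mathbb{C})$, and a nondegenerate Hermitian matrix $B_\sigma$ with $B_\sigma\,\rho_\sigma(a^*)=\overline{\rho_\sigma(a)}^{t}B_\sigma$ for all $a\in A$. Let $h\in A\setminus\{0\}$ with $h^*=h$ be such that,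 up to the choice of the sign of $B_\sigma$, the Hermitian matrix $B_\sigma\rho_\sigma(h)$ has signature $(2,1)$ for the fixed embedding $\sigma$, and signature $(3,0)$ for every $\sigma$ whose restriction to $k$ differs from that of the fixed embedding. Let $\mathcal{O}\subset A$ be an $R_E$-order and $$\mathrm{SU}(h,\mathcal{O})=\{x\in \mathcal{O} : x \text{ has reduced norm } 1,\ x^*hx=h\}.$$ With $\rho$ and $B$ denoting $\rho_\sigma$ and $B_\sigma$ (with the above choice of sign) for the fixed embedding $\sigma$, and with $P\in\mathrm{GL}_3(\mathbb{C})$ such that $\overline{P}^{t}JP=B\rho(h)$, the map $x\mapsto P\rho(x)P^{-1}$ embeds $\mathrm{SU}(h,\mathcal{O})$ in $\mathrm{SU}(2,1)$. A subgroup $\Gamma<\mathrm{SU}(2,1)$ is called an arithmetic lattice of division algebra type if it is commensurable with the image of such an embedding, for some choice of the data above. Let $\Gamma<\mathrm{SU}(2,1)$ be an arithmetic lattice of division algebra type, and let $\tau\in\Gamma$ be an elliptic element whose action on $\mathbf{H}^2_{\mathbb{C}}$ has finite order $n\ge 2$. Then $3$ divides $\varphi(n)$ or $\varphi(3n)$,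 where $\varphi$ is Euler's totient function. In particular, if $n=p>3$ is prime, then $p\equiv 1\pmod 3$. -/

import Mathlib

open scoped Matrix NumberField LinearAlgebra.Projectivization
open NumberField

universe u v

/-- The matrix of the Hermitian form `|z₁|² + |z₂|² - |z₃|²` of signature `(2,1)` on `ℂ³`. -/
def stdForm : Matrix (Fin 3) (Fin 3) ℂ := Matrix.diagonal ![1, 1, -1]

/-- `SU(2,1)`: the matrices of determinant one that preserve the standard form. -/
def SU21 : Subgroup (Matrix.SpecialLinearGroup (Fin 3) ℂ) where
  carrier := {g | (g : Matrix (Fin 3) (Fin 3) ℂ)ᴴ * stdForm * g = stdForm}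
  one_mem' := by simp
  mul_mem' := by
    intro a b ha hb
    simp only [Set.mem_ofPred_eq, Matrix.SpecialLinearGroup.coe_mul,
      Matrix.conjTranspose_mul] at *
    calc _ = (b : Matrix (Fin 3) (Fin 3) ℂ)ᴴ *
          ((a : Matrix (Fin 3) (Fin 3) ℂ)ᴴ * stdForm * a) * b := by
            simp only [Matrix.mul_assoc]
      _ = stdForm := by rw [ha, hb]
  inv_mem' := by
    intro a ha
    simp only [Set.mem_ofPred_eq] at *
    have h1 : (a : Matrix (Fin 3) (Fin 3) ℂ) *
        ((a⁻¹ : Matrix.SpecialLinearGroup (Fin 3) ℂ) : Matrix (Fin 3) (Fin 3) ℂ) = 1 := by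
      rw [← Matrix.SpecialLinearGroup.coe_mul]; simp
    have h2 := congrArg Matrix.conjTranspose h1
    rw [Matrix.conjTranspose_mul, Matrix.conjTranspose_one] at h2
    nth_rewrite 1 [← ha]
    calc _ = (((a⁻¹ : Matrix.SpecialLinearGroup (Fin 3) ℂ) : Matrix (Fin 3) (Fin 3) ℂ)ᴴ *
            (a : Matrix (Fin 3) (Fin 3) ℂ)ᴴ) * stdForm * ((a : Matrix (Fin 3) (Fin 3) ℂ) *
        ((a⁻¹ : Matrix.SpecialLinearGroup (Fin 3) ℂ) : Matrix (Fin 3) (Fin 3) ℂ)) := by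
            simp only [Matrix.mul_assoc]
      _ = stdForm := by rw [h1, h2]; simp

/-- The value `⟨z, z⟩ = |z₁|² + |z₂|² - |z₃|²`. -/
noncomputable def stdNorm (z : Fin 3 → ℂ) : ℝ := ‖z 0‖ ^ 2 + ‖z 1‖ ^ 2 - ‖z 2‖ ^ 2

theorem stdNorm_eq (z : Fin 3 → ℂ) : ((stdNorm z : ℝ) : ℂ) = star z ⬝ᵥ (stdForm *ᵥ z) := by
  simp [stdNorm, stdForm, dotProduct, Fin.sum_univ_three, Matrix.mulVec_diagonal,
    ← Complex.conj_mul']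
  ring

theorem stdNorm_smul (g : SU21) (z : Fin 3 → ℂ) : stdNorm (g • z) = stdNorm z := by
  apply Complex.ofReal_injective
  have hg : ((g : Matrix.SpecialLinearGroup (Fin 3) ℂ) : Matrix (Fin 3) (Fin 3) ℂ)ᴴ *
    stdForm * (g : Matrix.SpecialLinearGroup (Fin 3) ℂ) = stdForm := g.2
  have hs : g • z =
      ((g : Matrix.SpecialLinearGroup (Fin 3) ℂ) : Matrix (Fin 3) (Fin 3) ℂ) *ᵥ z := rfl
  rw [stdNorm_eq, stdNorm_eq, hs, Matrix.star_mulVec, Matrix.dotProduct_mulVec,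
    Matrix.vecMul_vecMul, ← Matrix.dotProduct_mulVec, Matrix.mulVec_mulVec,
    hg]

/-- The complex hyperbolic plane `H²_ℂ` in the projective model: the set of negative lines
in `ℂ³`, with the action of `SU(2,1)` induced from the one on the projective plane. -/
def complexHyperbolicPlane : SubMulAction SU21 (ℙ ℂ (Fin 3 → ℂ)) where
  carrier := {l | ∀ z ∈ l.submodule, z ≠ 0 → stdNorm z < 0}
  smul_mem' := by
    intro g l hl
    induction l using Projectivization.ind with
    | h w hw =>
      simp only [Set.mem_ofPred_eq] at *
      have hgw : g • w ≠ 0 := (smul_ne_zero_iff_ne g).mpr hw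
      have hmk : g • Projectivization.mk ℂ w hw = Projectivization.mk ℂ (g • w) hgw := rfl
      rw [hmk]
      intro z hz hz0
      rw [Projectivization.submodule_mk, Submodule.mem_span_singleton] at hz
      obtain ⟨c, rfl⟩ := hz
      rw [← smul_comm g c w, stdNorm_smul]
      refine hl _ ?_ ?_
      · rw [Projectivization.submodule_mk]
        exact Submodule.smul_mem _ _ (Submodule.mem_span_singleton_self w)
      · rintro h
        apply hz0
        rw [← smul_comm g c w, h, smul_zero]

/-- An element of `SU(2,1)` is elliptic if it has a fixed point in the complex hyperbolic plane. -/
def IsElliptic (g : SU21) : Prop := ∃ x : complexHyperbolicPlane, g • x = x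

/-- The order of the transformation of the complex hyperbolic plane defined by `g`
(with value `0` if the order is infinite). -/
noncomputable def actionOrder (g : SU21) : ℕ :=
  orderOf (MulAction.toPermHom SU21 complexHyperbolicPlane g)

/-- The Hermitian matrix `M` has signature `(p, q)`: it has `p` positive and `q` negative
eigenvalues, counted with multiplicity. -/
def HasSignature (M : Matrix (Fin 3) (Fin 3) ℂ) (p q : ℕ) : Prop :=
  ∃ hM : M.IsHermitian, {i | 0 < hM.eigenvalues i}.ncard = p ∧
    {i | hM.eigenvalues i < 0}.ncard = q

section DivisionAlgebra

/-- `ρ : A → M₃(ℂ)` is a matrix embedding of the `E`-algebra `A` over `σ : E → ℂ`. When `A` is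
central simple of dimension nine, it induces an isomorphism `A ⊗_{E,σ} ℂ ≅ M₃(ℂ)`, and
`det (ρ a)` is the image under `σ` of the reduced norm of `a`. -/
def IsMatrixEmbedding {E : Type u} [Field E] {A : Type v} [DivisionRing A] [Algebra E A]
    (σ : E →+* ℂ) (ρ : A →+* Matrix (Fin 3) (Fin 3) ℂ) : Prop :=
  ∀ e : E, ρ (algebraMap E A e) = Matrix.scalar (Fin 3) (σ e)

/-- The involution of `A` (written `star`) corresponds under `ρ` to the adjoint involution
`X ↦ B⁻¹ Xᴴ B` of the nondegenerate Hermitian form with matrix `B`. Such a `B` is unique up to a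
nonzero real factor. -/
def IsAdjointForm {A : Type v} [DivisionRing A] [StarRing A]
    (ρ : A →+* Matrix (Fin 3) (Fin 3) ℂ) (B : Matrix (Fin 3) (Fin 3) ℂ) : Prop :=
  B.IsHermitian ∧ IsUnit B.det ∧ ∀ a : A, B * ρ (star a) = (ρ a)ᴴ * B

/-- The Hermitian element `h` has signature `(p, q)` at the embedding `σ`: the Hermitian form
`B * ρ h` that it defines on `ℂ³` has signature `(p, q)`, for a suitable choice of the sign
of `B`. -/
def HasSignatureAt {E : Type u} [Field E] {A : Type v} [DivisionRing A] [Algebra E A]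
    [StarRing A] (σ : E →+* ℂ) (h : A) (p q : ℕ) : Prop :=
  ∃ (ρ : A →+* Matrix (Fin 3) (Fin 3) ℂ) (B : Matrix (Fin 3) (Fin 3) ℂ),
    IsMatrixEmbedding σ ρ ∧ IsAdjointForm ρ B ∧ HasSignature (B * ρ h) p q

/-- The group `SU(h, A)` of the elements `x` of reduced norm one with `star x * h * x = h`. -/
def SUA {A : Type v} [DivisionRing A] [StarRing A]
    (ρ : A →+* Matrix (Fin 3) (Fin 3) ℂ) (h : A) : Subgroup Aˣ where
  carrier := {x | star (x : A) * h * x = h ∧ (ρ x).det = 1}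
  one_mem' := by simp
  mul_mem' := by
    rintro a b ⟨ha, ha'⟩ ⟨hb, hb'⟩
    refine ⟨?_, by simp [ha', hb']⟩
    calc star ((a * b : Aˣ) : A) * h * ((a * b : Aˣ) : A)
        = star (b : A) * (star (a : A) * h * a) * b := by
          simp only [Units.val_mul, star_mul, mul_assoc]
      _ = h := by rw [ha, hb]
  inv_mem' := by
    rintro a ⟨ha, ha'⟩
    have h1 : (a : A) * ((a⁻¹ : Aˣ) : A) = 1 := a.mul_inv
    have h2 : star ((a⁻¹ : Aˣ) : A) * star (a : A) = 1 := by rw [← star_mul, h1, star_one]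
    refine ⟨?_, ?_⟩
    · calc star ((a⁻¹ : Aˣ) : A) * h * ((a⁻¹ : Aˣ) : A)
          = star ((a⁻¹ : Aˣ) : A) * (star (a : A) * h * a) * ((a⁻¹ : Aˣ) : A) := by rw [ha]
        _ = (star ((a⁻¹ : Aˣ) : A) * star (a : A)) * h * ((a : A) * ((a⁻¹ : Aˣ) : A)) := by
          simp only [mul_assoc]
        _ = h := by rw [h1, h2, one_mul, mul_one]
    · have h3 : (ρ a).det * (ρ ((a⁻¹ : Aˣ) : A)).det = 1 := by
        rw [← Matrix.det_mul, ← map_mul, h1, map_one, Matrix.det_one]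
      rwa [ha', one_mul] at h3

/-- `O` is an order of `A` over the ring of integers of `E`: a subring containing the ring of
integers, finitely generated as a module over it, which spans `A` over `E`. -/
def IsROrder (E : Type u) [Field E] {A : Type v} [DivisionRing A] [Algebra E A]
    (O : Subalgebra (𝓞 E) A) : Prop :=
  (Subalgebra.toSubmodule O).FG ∧ Submodule.span E (O : Set A) = ⊤

/-- The inverse of an element of reduced norm one of an order lies in the order. -/
theorem inv_mem_order {E : Type u} [Field E] [NumberField E] {A : Type v} [DivisionRing A]
    [Algebra E A] (ρ : A →+* Matrix (Fin 3) (Fin 3) ℂ) {O : Subalgebra (𝓞 E) A}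
    (hO : IsROrder E O) {x : A} (hx : x ∈ O) (hdet : (ρ x).det = 1) : x⁻¹ ∈ O := by
  have hx0 : x ≠ 0 := by
    rintro rfl
    simp at hdet
  -- the element is integral over the integers
  have hint : IsIntegral ℤ x := by
    have : Module.Finite (𝓞 E) O := .of_fg hO.1
    have : Module.Finite ℤ O := Module.Finite.trans (𝓞 E) O
    have h1 : IsIntegral ℤ (⟨x, hx⟩ : O) := .of_finite ℤ _
    obtain ⟨p, hp, hp0⟩ := h1
    refine ⟨p, hp, ?_⟩
    have h2 := congrArg (O.val : O →+* A) hp0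
    rw [Polynomial.hom_eval₂,
      RingHom.ext_int ((O.val : O →+* A).comp (algebraMap ℤ O)) (algebraMap ℤ A), map_zero] at h2
    exact h2
  -- eigenvalues and eigenvectors
  have heig : ∀ (μ : ℂ), μ ∈ (ρ x).charpoly.roots →
      ∃ w : Fin 3 → ℂ, w ≠ 0 ∧ ρ x *ᵥ w = μ • w := by
    intro μ hμ
    rw [Polynomial.mem_roots (Matrix.charpoly_monic _).ne_zero, Polynomial.IsRoot.def,
      Matrix.eval_charpoly] at hμ
    obtain ⟨w, hw, hw0⟩ := Matrix.exists_mulVec_eq_zero_iff.mpr hμ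
    refine ⟨w, hw, ?_⟩
    rw [Matrix.sub_mulVec, sub_eq_zero] at hw0
    rw [← hw0]
    simp [Matrix.scalar_apply, ← Matrix.smul_one_eq_diagonal, Matrix.smul_mulVec]
  have hpow : ∀ (M : Matrix (Fin 3) (Fin 3) ℂ) (μ : ℂ) (w : Fin 3 → ℂ), M *ᵥ w = μ • w →
      ∀ p : Polynomial ℤ, (Polynomial.aeval M p) *ᵥ w = (Polynomial.aeval μ p) • w := by
    intro M μ w hw p
    have hk : ∀ k : ℕ, (M ^ k) *ᵥ w = μ ^ k • w := by
      intro k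
      induction k with
      | zero => simp
      | succ k ih =>
        rw [pow_succ, ← Matrix.mulVec_mulVec, hw, Matrix.mulVec_smul, ih, smul_smul, pow_succ']
    rw [Polynomial.aeval_eq_sum_range, Polynomial.aeval_eq_sum_range, Matrix.sum_mulVec,
      Finset.sum_smul]
    refine Finset.sum_congr rfl fun k _ => ?_
    rw [Matrix.smul_mulVec, hk, smul_assoc]
  have hρ : ∀ (a : A) (p : Polynomial ℤ),
      ρ (Polynomial.aeval a p) = Polynomial.aeval (ρ a) p := by
    intro a p
    exact (Polynomial.aeval_algHom_apply ρ.toIntAlgHom a p).symm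
  have hrootint : ∀ μ ∈ (ρ x).charpoly.roots, IsIntegral ℤ μ := by
    intro μ hμ
    obtain ⟨w, hw, hxw⟩ := heig μ hμ
    obtain ⟨p, hp, hp0⟩ := hint
    refine ⟨p, hp, ?_⟩
    have h1 := hpow _ _ _ hxw p
    rw [← hρ] at h1
    have h2 : Polynomial.aeval x p = 0 := hp0
    rw [h2, map_zero, Matrix.zero_mulVec] at h1
    exact (smul_eq_zero.mp h1.symm).resolve_right hw
  have hprod : (ρ x).charpoly.roots.prod = 1 := by
    rw [← Matrix.det_eq_prod_roots_charpoly, hdet]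
  obtain ⟨μ, hμ⟩ : ∃ μ, μ ∈ (ρ x).charpoly.roots := by
    apply Multiset.exists_mem_of_ne_zero
    intro h0
    have hs := IsAlgClosed.card_roots_eq_natDegree (p := (ρ x).charpoly)
    rw [h0, Matrix.charpoly_natDegree_eq_dim] at hs
    simp at hs
  have hμinv : IsIntegral ℤ μ⁻¹ := by
    have h1 : μ * ((ρ x).charpoly.roots.erase μ).prod = 1 := by
      rw [Multiset.prod_erase hμ, hprod]
    rw [← eq_inv_of_mul_eq_one_right h1]
    exact IsIntegral.multiset_prod fun ν hν => hrootint ν (Multiset.mem_of_mem_erase hν)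
  have hμ0 : μ ≠ 0 := by
    rintro rfl
    exact one_ne_zero (hprod.symm.trans (Multiset.prod_eq_zero hμ))
  obtain ⟨w, hw, hxw⟩ := heig μ hμ
  have hinvw : ρ x⁻¹ *ᵥ w = μ⁻¹ • w := by
    have h1 : ρ x⁻¹ *ᵥ (ρ x *ᵥ w) = w := by
      rw [Matrix.mulVec_mulVec, ← map_mul, inv_mul_cancel₀ hx0, map_one, Matrix.one_mulVec]
    rw [hxw, Matrix.mulVec_smul] at h1
    calc ρ x⁻¹ *ᵥ w = μ⁻¹ • (μ • (ρ x⁻¹ *ᵥ w)) := by rw [smul_smul, inv_mul_cancel₀ hμ0, one_smul]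
      _ = μ⁻¹ • w := by rw [h1]
  obtain ⟨q, hq, hq0⟩ := hμinv
  have hq1 : Polynomial.aeval x⁻¹ q = 0 := by
    by_contra hne
    have h1 := hpow _ _ _ hinvw q
    have h2 : Polynomial.aeval μ⁻¹ q = 0 := hq0
    rw [h2, zero_smul, ← hρ] at h1
    have h3 : ρ (Polynomial.aeval x⁻¹ q)⁻¹ *ᵥ (ρ (Polynomial.aeval x⁻¹ q) *ᵥ w) = w := by
      rw [Matrix.mulVec_mulVec, ← map_mul, inv_mul_cancel₀ hne, map_one, Matrix.one_mulVec]
    rw [h1, Matrix.mulVec_zero] at h3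
    exact hw h3.symm
  obtain ⟨n, hn⟩ : ∃ n, q.natDegree = n + 1 := by
    refine Nat.exists_eq_succ_of_ne_zero fun h0 => ?_
    rw [hq.natDegree_eq_zero.mp h0] at hq1
    simp at hq1
  have hxinv : x⁻¹ = -∑ i ∈ Finset.range (n + 1), q.coeff i • x ^ (n - i) := by
    rw [Polynomial.aeval_eq_sum_range, hn, Finset.sum_range_succ, ← hn, hq.coeff_natDegree, hn,
      one_smul] at hq1
    have h1 := congrArg (fun y => y * x ^ n) hq1
    simp only [add_mul, zero_mul, Finset.sum_mul] at h1
    have h2 : x⁻¹ ^ (n + 1) * x ^ n = x⁻¹ := by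
      rw [pow_succ', mul_assoc, inv_pow, inv_mul_cancel₀ (pow_ne_zero _ hx0), mul_one]
    rw [h2] at h1
    rw [eq_neg_iff_add_eq_zero, add_comm, ← h1]
    congr 1
    refine Finset.sum_congr rfl fun i hi => ?_
    have hle : i ≤ n := Nat.lt_succ_iff.mp (Finset.mem_range.mp hi)
    rw [smul_mul_assoc]
    congr 1
    conv_rhs => rw [← Nat.add_sub_cancel' hle, pow_add, ← mul_assoc, inv_pow,
      inv_mul_cancel₀ (pow_ne_zero _ hx0), one_mul]
  rw [hxinv]
  exact neg_mem (sum_mem fun i _ => zsmul_mem (pow_mem hx _) _)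

/-- The group `SU(h, O) = SU(h, A) ∩ O`. -/
def SUO {E : Type u} [Field E] [NumberField E] {A : Type v} [DivisionRing A] [Algebra E A]
    [StarRing A] (ρ : A →+* Matrix (Fin 3) (Fin 3) ℂ) (h : A) (O : Subalgebra (𝓞 E) A)
    (hO : IsROrder E O) : Subgroup Aˣ where
  carrier := {x | x ∈ SUA ρ h ∧ (x : A) ∈ O}
  one_mem' := ⟨one_mem _, one_mem O⟩
  mul_mem' := fun ha hb => ⟨mul_mem ha.1 hb.1, mul_mem ha.2 hb.2⟩
  inv_mem' := fun {x} hx => ⟨inv_mem hx.1, by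
    have := inv_mem_order ρ hO hx.2 hx.1.2
    simpa using this⟩

/-- The homomorphism `x ↦ P ρ(x) P⁻¹` from `Aˣ` to `GL₃(ℂ)`. -/
noncomputable def conjEmbedding {A : Type v} [DivisionRing A]
    (ρ : A →+* Matrix (Fin 3) (Fin 3) ℂ) (P : GL (Fin 3) ℂ) : Aˣ →* GL (Fin 3) ℂ :=
  (MulAut.conj P).toMonoidHom.comp (Units.map (ρ : A →* Matrix (Fin 3) (Fin 3) ℂ))

/-- `Γ` is an arithmetic lattice of division algebra type in `SU(2,1)`: there are
* a CM field `E` (with totally real subfield `k = maximalRealSubfield E`) and an embedding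
  `ι : E → ℂ`;
* a division algebra `A` of degree three with center `E`, with an involution of the second kind;
* a nonzero Hermitian element `h` of `A`, of signature `(2,1)` at `ι` and of signature `(3,0)` at
  every embedding of `E` that does not restrict to the same embedding of `k` as `ι`;
* an order `O` of `A` over the ring of integers of `E`;

such that `Γ` is commensurable with the image of `SU(h, O)` in `SU(2,1)`, where `SU(h, A)` is
embedded in `SU(2,1)` by a matrix embedding `ρ` over `ι`, followed by the conjugation with a
matrix `P` that takes the Hermitian form `B * ρ h` to the standard one. -/
def IsOfDivisionAlgebraType (Γ : Subgroup SU21) : Prop :=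
  ∃ (E : Type u) (_ : Field E) (_ : NumberField E) (_ : IsCMField E) (ι : E →+* ℂ)
    (A : Type v) (_ : DivisionRing A) (_ : Algebra E A) (_ : StarRing A)
    (h : A) (O : Subalgebra (𝓞 E) A) (hO : IsROrder E O)
    (ρ : A →+* Matrix (Fin 3) (Fin 3) ℂ) (B : Matrix (Fin 3) (Fin 3) ℂ) (P : GL (Fin 3) ℂ),
    Algebra.IsCentral E A ∧ Module.finrank E A = 9 ∧
    (∀ e : E, star (algebraMap E A e) = algebraMap E A (IsCMField.complexConj E e)) ∧
    h ≠ 0 ∧ star h = h ∧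
    HasSignatureAt ι h 2 1 ∧
    (∀ σ : E →+* ℂ,
      σ.comp (algebraMap (maximalRealSubfield E) E) ≠
        ι.comp (algebraMap (maximalRealSubfield E) E) →
      HasSignatureAt σ h 3 0) ∧
    IsMatrixEmbedding ι ρ ∧ IsAdjointForm ρ B ∧
    (P : Matrix (Fin 3) (Fin 3) ℂ)ᴴ * stdForm * P = B * ρ h ∧
    Subgroup.Commensurable
      (Γ.map (Matrix.SpecialLinearGroup.toGL.comp SU21.subtype))
      ((SUO ρ h O hO).map (conjEmbedding ρ P))

/-- The embedding used above does take `SU(h, A)` into `SU(2,1)`. -/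
theorem conjEmbedding_mem {A : Type v} [DivisionRing A] [StarRing A]
    (ρ : A →+* Matrix (Fin 3) (Fin 3) ℂ) (B : Matrix (Fin 3) (Fin 3) ℂ) (P : GL (Fin 3) ℂ)
    (h : A) (hB : IsAdjointForm ρ B)
    (hP : (P : Matrix (Fin 3) (Fin 3) ℂ)ᴴ * stdForm * P = B * ρ h) :
    (SUA ρ h).map (conjEmbedding ρ P) ≤
      (⊤ : Subgroup SU21).map (Matrix.SpecialLinearGroup.toGL.comp SU21.subtype) := by
  rintro _ ⟨x, ⟨hx, hdet⟩, rfl⟩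
  have hval : ((conjEmbedding ρ P x : GL (Fin 3) ℂ) : Matrix (Fin 3) (Fin 3) ℂ) =
      (P : Matrix (Fin 3) (Fin 3) ℂ) * ρ x * ((P⁻¹ : GL (Fin 3) ℂ) : Matrix _ _ ℂ) := by
    simp [conjEmbedding]
  have hP1 : ((P⁻¹ : GL (Fin 3) ℂ) : Matrix (Fin 3) (Fin 3) ℂ) * P = 1 := P.inv_mul
  have hP2 : (P : Matrix (Fin 3) (Fin 3) ℂ) * ((P⁻¹ : GL (Fin 3) ℂ) : Matrix _ _ ℂ) = 1 :=
    P.mul_inv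
  have hP3 := congrArg Matrix.conjTranspose hP2
  rw [Matrix.conjTranspose_mul, Matrix.conjTranspose_one] at hP3
  have hd : ((P : Matrix (Fin 3) (Fin 3) ℂ) * ρ x *
      ((P⁻¹ : GL (Fin 3) ℂ) : Matrix _ _ ℂ)).det = 1 := by
    rw [Matrix.det_mul, Matrix.det_mul, hdet, mul_one, ← Matrix.det_mul, hP2, Matrix.det_one]
  refine ⟨⟨⟨_, hd⟩, ?_⟩, trivial, ?_⟩
  · show ((P : Matrix (Fin 3) (Fin 3) ℂ) * ρ x * ((P⁻¹ : GL (Fin 3) ℂ) : Matrix _ _ ℂ))ᴴ *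
      stdForm * ((P : Matrix (Fin 3) (Fin 3) ℂ) * ρ x *
        ((P⁻¹ : GL (Fin 3) ℂ) : Matrix _ _ ℂ)) = stdForm
    have key : (ρ x)ᴴ * (B * ρ h) * ρ x = B * ρ h := by
      rw [← Matrix.mul_assoc, ← hB.2.2, Matrix.mul_assoc, Matrix.mul_assoc, ← map_mul, ← map_mul,
        ← mul_assoc, hx]
    rw [Matrix.conjTranspose_mul, Matrix.conjTranspose_mul]
    calc _ = ((P⁻¹ : GL (Fin 3) ℂ) : Matrix (Fin 3) (Fin 3) ℂ)ᴴ *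
          ((ρ x)ᴴ * ((P : Matrix (Fin 3) (Fin 3) ℂ)ᴴ * stdForm * P) * ρ x) *
          ((P⁻¹ : GL (Fin 3) ℂ) : Matrix (Fin 3) (Fin 3) ℂ) := by
            simp only [Matrix.mul_assoc]
      _ = (((P⁻¹ : GL (Fin 3) ℂ) : Matrix (Fin 3) (Fin 3) ℂ)ᴴ *
          (P : Matrix (Fin 3) (Fin 3) ℂ)ᴴ) * stdForm * ((P : Matrix (Fin 3) (Fin 3) ℂ) *
          ((P⁻¹ : GL (Fin 3) ℂ) : Matrix (Fin 3) (Fin 3) ℂ)) := by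
            rw [hP, key, ← hP]; simp only [Matrix.mul_assoc]
      _ = stdForm := by rw [hP2, hP3, one_mul, mul_one]
  · apply Units.ext
    rw [hval]
    rfl

end DivisionAlgebra

/-!
Write `τ` for the given element of `Γ`, and let `n` be its order modulo scalars, which is the order
of its action on the complex hyperbolic plane. The proof has an arithmetic part, which moves `τ`
into the division algebra `A`, and a Galois-theoretic part, which reads off `n`.

*Subgroups of finite index of `SU(h, O)` generate `A`.* Subalgebras of `A` have dimension 1, 3 or 9
over the center `E`, so it is enough that only `E` centralizes such a subgroup `Δ`
(`Algebra.adjoin_eq_top_of_centralizer`). Let `z` commute with `Δ`, and let `Y` be a nilpotent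
element with `Y ^ 2 = 0` of the Lie algebra of the isometry group `SU(2,1)` at the fixed embedding,
so that `g t = 1 + t Y` is an isometry. Apply Minkowski's theorem to the lattice of `O` in the
product of the matrix algebras at all places. It gives, for each natural number `t`, a nonzero
lattice point `x t` with `g t * x t` in a fixed compact set. The reduced norm of `x t`, the Hermitian
value `star (x t) * h * x t`, and the class of `x t` modulo a multiple of the reduced norm take
finitely many values. Two points with the same values differ by an element of `SU(h, O)`, and so
`g t * γ t` stays in a compact set for infinitely many `t`, with `γ t` in `Δ`
(`IsROrder.exists_infinite_translates_mem_isCompact`). Then `g t * z * (g t)⁻¹` is bounded for these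
`t`; being a polynomial in `t` it is constant, and `z` commutes with `Y`. Taking for `Y` the maps
`w ↦ i ⟨v, w⟩ v` with `v` isotropic, every isotropic vector is an eigenvector of `z`, and `z` is
scalar.

*The element `τ` comes from `A`.* The conjugate of `SU(h, O)` by `τ` is commensurable with
`SU(h, O)`, hence conjugation by `τ` maps `A` into itself. By the Skolem–Noether theorem
(`exists_smul_map_eq_of_conj`), `τ` is a scalar multiple of the image of some `a` in `A`.

*The order.* The element `a` is not in `E`, so its minimal polynomial over `E` is an irreducible
cubic, and it divides `X ^ n - e` with `e = a ^ n` in `E`. An element of order three of its Galois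
group moves a root `α`, and multiplies it by an `n`-th root of unity `ζ`. If it moves `ζ`, then it
acts on the roots of unity through an element of order three of `(ℤ/m)ˣ` with `m ∣ n`, so
`3 ∣ φ n`. If it fixes `ζ`, then `ζ ^ 3 = 1`, the polynomial is `X ^ 3 - c`, and `a ^ 3` is in `E`,
so `n = 3`.
-/

/-! ### Representations of a central division algebra over an extension field -/

section CentralDivisionAlgebra

variable {E F A M : Type*} [Field E] [Field F] [Algebra E F] [DivisionRing A] [Algebra E A]
  [Ring M] [Algebra F M] [Algebra E M] [IsScalarTower E F M]

/-- Artin's shortest relation argument: scalars that are linearly independent over the center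
remain independent with coefficients in the algebra. -/
theorem eq_zero_of_sum_smul_map_eq_zero [Algebra.IsCentral E A] [Nontrivial M] (ρ : A →ₐ[E] M)
    {κ : Type*} {c : κ → F} (hc : LinearIndependent E c) (s : Finset κ) :
    ∀ a : κ → A, ∑ i ∈ s, c i • ρ (a i) = 0 → ∀ i ∈ s, a i = 0 := by
  classical
  induction s using Finset.induction_on with
  | empty => simp
  | insert k s hk ih =>
    intro a ha
    by_cases hak : a k = 0
    · rw [Finset.sum_insert hk, hak, map_zero, smul_zero, zero_add] at ha
      intro i hi
      rcases Finset.mem_insert.mp hi with rfl | hi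
      · exact hak
      · exact ih a ha i hi
    · exfalso
      -- normalize the coefficient at `k` to be one
      obtain ⟨b, hbk, hb⟩ : ∃ b : κ → A, b k = 1 ∧ ∑ i ∈ insert k s, c i • ρ (b i) = 0 := by
        refine ⟨fun i => (a k)⁻¹ * a i, inv_mul_cancel₀ hak, ?_⟩
        have := congrArg (fun y => ρ (a k)⁻¹ * y) ha
        simpa [Finset.mul_sum, mul_smul_comm] using this
      -- the commutators with any `x` give a shorter relation
      have hcomm : ∀ i ∈ s, ∀ x : A, x * b i = b i * x := by
        intro i hi x
        have h1 : ∑ i ∈ insert k s, c i • ρ (x * b i - b i * x) = 0 := by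
          have e1 := congrArg (fun y => ρ x * y - y * ρ x) hb
          simpa [Finset.mul_sum, Finset.sum_mul, mul_smul_comm, smul_mul_assoc, smul_sub] using e1
        rw [Finset.sum_insert hk, hbk, mul_one, one_mul, sub_self, map_zero, smul_zero,
          zero_add] at h1
        exact sub_eq_zero.mp (ih _ h1 i hi)
      have hcen : ∀ i ∈ insert k s, ∃ e : E, b i = algebraMap E A e := by
        intro i hi
        rcases Finset.mem_insert.mp hi with rfl | hi
        · exact ⟨1, by rw [hbk, map_one]⟩
        · exact (Algebra.IsCentral.mem_center_iff E).mp
            (Subalgebra.mem_center_iff.mpr fun x => hcomm i hi x)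
      choose! e he using hcen
      have h2 : ∑ i ∈ insert k s, e i • c i = 0 := by
        apply FaithfulSMul.algebraMap_injective F M
        rw [map_zero, ← hb, map_sum]
        refine Finset.sum_congr rfl fun i hi => ?_
        rw [he i hi, AlgHom.commutes, Algebra.smul_def, Algebra.smul_def, map_mul,
          ← IsScalarTower.algebraMap_apply, Algebra.commutes]
      have h3 := linearIndependent_iff'.mp hc _ e h2 k (Finset.mem_insert_self k s)
      have h4 := he k (Finset.mem_insert_self k s)
      rw [h3, hbk, map_zero] at h4
      exact one_ne_zero h4

/-- Regrouping of a combination of elements `ρ (a j)` along a basis of the scalar extension. -/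
theorem sum_smul_map_eq_sum_basis_smul_map (ρ : A →ₐ[E] M) {κ : Type*} (b : Module.Basis κ E F)
    {ι : Type*} (s : Finset ι) (d : ι → F) (a : ι → A) :
    ∃ S : Finset κ, (∀ j ∈ s, d j = ∑ k ∈ S, b.repr (d j) k • b k) ∧
      ∑ j ∈ s, d j • ρ (a j) = ∑ k ∈ S, b k • ρ (∑ j ∈ s, b.repr (d j) k • a j) := by
  classical
  let S : Finset _ := s.biUnion fun j => (b.repr (d j)).support
  have hexp : ∀ j ∈ s, d j = ∑ k ∈ S, b.repr (d j) k • b k := by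
    intro j hj
    conv_lhs => rw [← b.linearCombination_repr (d j), Finsupp.linearCombination_apply]
    refine Finsupp.sum_of_support_subset _ ?_ _ (by simp)
    exact Finset.subset_biUnion_of_mem (fun j => (b.repr (d j)).support) hj
  refine ⟨S, hexp, ?_⟩
  simp_rw [map_sum, map_smul, Finset.smul_sum]
  rw [Finset.sum_comm]
  refine Finset.sum_congr rfl fun j hj => ?_
  conv_lhs => rw [hexp j hj, Finset.sum_smul]
  refine Finset.sum_congr rfl fun k _ => ?_
  rw [smul_assoc, smul_comm]

theorem LinearIndependent.map_of_isCentral [Algebra.IsCentral E A] [Nontrivial M]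
    (ρ : A →ₐ[E] M) {ι : Type*} {a : ι → A} (ha : LinearIndependent E a) :
    LinearIndependent F (fun i => ρ (a i)) := by
  rw [linearIndependent_iff']
  intro s d hd i hi
  let b := Module.Basis.ofVectorSpace E F
  obtain ⟨S, hexp, hS⟩ := sum_smul_map_eq_sum_basis_smul_map ρ b s d a
  have h2 := eq_zero_of_sum_smul_map_eq_zero ρ b.linearIndependent S _ (hS.symm.trans hd)
  have h3 : ∀ k ∈ S, b.repr (d i) k = 0 := fun k hk =>
    linearIndependent_iff'.mp ha s _ (h2 k hk) i hi
  rw [hexp i hi]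
  exact Finset.sum_eq_zero fun k hk => by rw [h3 k hk, zero_smul]

theorem span_range_eq_top_of_isCentral [Algebra.IsCentral E A] [Nontrivial M]
    [FiniteDimensional E A] [FiniteDimensional F M] (ρ : A →ₐ[E] M)
    (hdim : Module.finrank E A = Module.finrank F M) :
    Submodule.span F (Set.range ρ) = ⊤ := by
  let b := Module.finBasis E A
  have h1 := (b.linearIndependent.map_of_isCentral (F := F) ρ).span_eq_top_of_card_eq_finrank'
    (by rw [Fintype.card_fin, hdim])
  rw [eq_top_iff, ← h1]
  exact Submodule.span_mono (Set.range_subset_iff.mpr fun i => ⟨b i, rfl⟩)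

/-- A form of the Skolem–Noether theorem: an element that conjugates `ρ A` into itself is, up to
a scalar, the image of a nonzero element of `A`. -/
theorem exists_smul_map_eq_of_conj [Algebra.IsCentral E A] [Nontrivial M]
    [FiniteDimensional E A] [FiniteDimensional F M] [Algebra.IsCentral F M] (ρ : A →ₐ[E] M)
    (hdim : Module.finrank E A = Module.finrank F M) {T : M} (hT : T ≠ 0)
    (hconj : ∀ x : A, ∃ y : A, ρ x * T = T * ρ y) :
    ∃ (a : A) (c : F), a ≠ 0 ∧ T = c • ρ a := by
  let b := Module.Basis.ofVectorSpace E F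
  -- expand `T` along a basis of `F` over `E`, with coefficients in `ρ A`
  obtain ⟨S, a, hSa⟩ : ∃ (S : Finset _) (a : _ → A), T = ∑ k ∈ S, b k • ρ (a k) := by
    have hT : T ∈ Submodule.span F (Set.range ρ) := by
      rw [span_range_eq_top_of_isCentral ρ hdim]; trivial
    obtain ⟨d, rfl⟩ := (Finsupp.mem_span_range_iff_exists_finsupp).mp hT
    obtain ⟨S, -, hS⟩ := sum_smul_map_eq_sum_basis_smul_map ρ b d.support d id
    exact ⟨S, _, hS⟩
  choose y hy using hconj
  have hcomm : ∀ x, ∀ k ∈ S, x * a k = a k * y x := by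
    intro x k hk
    refine sub_eq_zero.mp (eq_zero_of_sum_smul_map_eq_zero ρ b.linearIndependent S
      (fun k => x * a k - a k * y x) ?_ k hk)
    have h1 := hy x
    rw [hSa, Finset.mul_sum, Finset.sum_mul, ← sub_eq_zero, ← Finset.sum_sub_distrib] at h1
    simpa [mul_smul_comm, smul_mul_assoc, smul_sub] using h1
  obtain ⟨k, hk, hak⟩ : ∃ k ∈ S, a k ≠ 0 := by
    by_contra! h
    exact hT (by rw [hSa]; exact Finset.sum_eq_zero fun k hk => by simp [h k hk])
  -- `T (ρ (a k))⁻¹` commutes with `ρ A`, hence with its span `M`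
  have hcen : T * ρ (a k)⁻¹ ∈ Subalgebra.center F M := by
    rw [Subalgebra.mem_center_iff]
    intro z
    have hz : z ∈ Submodule.span F (Set.range ρ) := by
      rw [span_range_eq_top_of_isCentral ρ hdim]; trivial
    induction hz using Submodule.span_induction with
    | mem z hz =>
      obtain ⟨x, rfl⟩ := hz
      have h2 : y x * (a k)⁻¹ = (a k)⁻¹ * x := by
        rw [eq_inv_mul_iff_mul_eq₀ hak, ← mul_assoc, ← hcomm x k hk, mul_assoc,
          mul_inv_cancel₀ hak, mul_one]
      rw [← mul_assoc, hy, mul_assoc, ← map_mul, h2, map_mul, mul_assoc]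
    | zero => simp
    | add z w _ _ hz hw => rw [add_mul, mul_add, hz, hw]
    | smul c z _ hz => rw [smul_mul_assoc, mul_smul_comm, hz]
  obtain ⟨c, hc⟩ := (Algebra.IsCentral.mem_center_iff F).mp hcen
  refine ⟨a k, c, hak, ?_⟩
  rw [Algebra.smul_def, ← hc, mul_assoc, ← map_mul, inv_mul_cancel₀ hak, map_one, mul_one]

end CentralDivisionAlgebra

/-! ### Division algebras of degree three -/

section DegreeThree

open Polynomial Module

variable {E F A : Type*} [Field E] [Field F] [DivisionRing A] [Algebra E A]

theorem Subalgebra.finrank_eq_of_finrank_eq_nine (hA : finrank E A = 9) (D : Subalgebra E A) :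
    finrank E D = 1 ∨ finrank E D = 3 ∨ finrank E D = 9 := by
  have : FiniteDimensional E A := .of_finrank_pos (by omega)
  let _ := divisionRingOfFiniteDimensional E D
  have h1 : finrank E D ∣ 3 ^ 2 := ⟨_, hA.symm.trans (finrank_mul_finrank E D A).symm⟩
  obtain ⟨k, hk, h2⟩ := (Nat.dvd_prime_pow Nat.prime_three).mp h1
  interval_cases k <;> simp_all

theorem Algebra.commute_of_mem_adjoin_singleton {x y z : A} (hy : y ∈ adjoin E {x})
    (hz : z ∈ adjoin E {x}) : Commute y z := by
  refine commute_of_mem_adjoin_of_forall_mem_commute hz ?_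
  rintro _ rfl
  exact (commute_of_mem_adjoin_self hy).symm

theorem Algebra.IsCentral.exists_eq_algebraMap_of_forall_commute [IsCentral E A] {x : A}
    (hx : ∀ y : A, y * x = x * y) : ∃ e : E, x = algebraMap E A e :=
  (mem_center_iff E).mp (Subalgebra.mem_center_iff.mpr hx)

theorem Algebra.IsCentral.exists_not_commute [IsCentral E A] (hA : finrank E A = 9) :
    ∃ x y : A, x * y ≠ y * x := by
  by_contra! h
  have h1 : (⊥ : Subalgebra E A) = ⊤ := by
    refine Algebra.eq_top_iff.mpr fun x => ?_
    obtain ⟨e, rfl⟩ := exists_eq_algebraMap_of_forall_commute (E := E) (x := x) fun y => h y x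
    exact Subalgebra.algebraMap_mem _ e
  rw [Subalgebra.bot_eq_top_iff_finrank_eq_one] at h1
  omega

theorem Algebra.finrank_adjoin_singleton_eq_three [IsCentral E A] (hA : finrank E A = 9) {x : A}
    (hx : x ∉ Set.range (algebraMap E A)) : finrank E (adjoin E {x}) = 3 := by
  have : FiniteDimensional E A := .of_finrank_pos (by omega)
  rcases (adjoin E {x}).finrank_eq_of_finrank_eq_nine hA with h | h | h
  · have hmem : x ∈ adjoin E {x} := subset_adjoin rfl
    rw [Subalgebra.eq_bot_of_finrank_one h] at hmem
    exact absurd (mem_bot.mp hmem) hx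
  · exact h
  · have htop : adjoin E {x} = ⊤ := toSubmodule_eq_top.1
      (Submodule.eq_top_of_finrank_eq ((Subalgebra.finrank_toSubmodule _).trans (h.trans hA.symm)))
    obtain ⟨y, z, hyz⟩ := IsCentral.exists_not_commute (E := E) hA
    exact absurd (commute_of_mem_adjoin_singleton (E := E) (x := x) (by rw [htop]; trivial)
      (by rw [htop]; trivial)) hyz

theorem minpoly.natDegree_eq_three [Algebra.IsCentral E A] (hA : finrank E A = 9) {x : A}
    (hx : x ∉ Set.range (algebraMap E A)) : (minpoly E x).natDegree = 3 := by
  classical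
  have : FiniteDimensional E A := .of_finrank_pos (by omega)
  have hint : IsIntegral E x := .of_finite E x
  have h3 := Algebra.finrank_adjoin_singleton_eq_three (E := E) hA hx
  rw [← Subalgebra.finrank_toSubmodule] at h3
  have hspan := Submodule.span_range_natDegree_eq_adjoin (minpoly.monic hint) (minpoly.aeval E x)
  apply le_antisymm
  · rw [← h3]
    have h4 := finrank_span_eq_card (linearIndependent_pow (K := E) x)
    rw [Fintype.card_fin] at h4
    refine h4.symm.le.trans (Submodule.finrank_mono ?_)
    rw [Submodule.span_le]
    rintro _ ⟨i, rfl⟩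
    exact (Algebra.adjoin E {x}).pow_mem (Algebra.subset_adjoin rfl) i
  · rw [← h3, ← hspan]
    refine (finrank_span_finset_le_card _).trans (Finset.card_image_le.trans ?_)
    simp

/-- A subset whose only centralizing elements are the central ones generates the algebra. -/
theorem Algebra.adjoin_eq_top_of_centralizer [IsCentral E A] (hA : finrank E A = 9) {S : Set A}
    (hS : ∀ z : A, (∀ s ∈ S, s * z = z * s) → z ∈ Set.range (algebraMap E A)) :
    adjoin E S = ⊤ := by
  have : FiniteDimensional E A := .of_finrank_pos (by omega)
  -- a commutative subalgebra that contains `S` would be the center, and `A` commutes with it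
  have hcomm : ∃ y ∈ adjoin E S, ∃ z ∈ adjoin E S, y * z ≠ z * y := by
    by_contra! h
    obtain ⟨y, z, hyz⟩ := IsCentral.exists_not_commute (E := E) hA
    obtain ⟨e, rfl⟩ := hS y fun s hs => by
      obtain ⟨e, rfl⟩ := hS s fun t ht => h t (subset_adjoin ht) s (subset_adjoin hs)
      exact commutes e y
    exact hyz (commutes e z)
  obtain ⟨y, hy, z, hz, hyz⟩ := hcomm
  rcases (adjoin E S).finrank_eq_of_finrank_eq_nine hA with h | h | h
  · rw [Subalgebra.eq_bot_of_finrank_one h] at hy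
    obtain ⟨e, rfl⟩ := mem_bot.mp hy
    exact absurd (commutes e z) hyz
  · have hy' : y ∉ Set.range (algebraMap E A) := by
      rintro ⟨e, rfl⟩
      exact hyz (commutes e z)
    have heq : adjoin E {y} = adjoin E S :=
      Subalgebra.eq_of_le_of_finrank_eq (adjoin_le (by simpa using hy))
        ((finrank_adjoin_singleton_eq_three (E := E) hA hy').trans h.symm)
    rw [← heq] at hy hz
    exact absurd (commute_of_mem_adjoin_singleton hy hz) hyz
  · exact toSubmodule_eq_top.1
      (Submodule.eq_top_of_finrank_eq ((Subalgebra.finrank_toSubmodule _).trans (h.trans hA.symm)))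

variable [Algebra E F]

/-- The characteristic polynomial of a noncentral element in a splitting representation of degree
three is its minimal polynomial over the center. -/
theorem charpoly_map_eq_minpoly_map [Algebra.IsCentral E A] (hA : finrank E A = 9)
    (ρ : A →ₐ[E] Matrix (Fin 3) (Fin 3) F) {x : A} (hx : x ∉ Set.range (algebraMap E A)) :
    (ρ x).charpoly = (minpoly E x).map (algebraMap E F) := by
  have : FiniteDimensional E A := .of_finrank_pos (by omega)
  have hmonic := (minpoly.monic (IsIntegral.of_finite E x)).map (algebraMap E F)
  have hdeg : ((minpoly E x).map (algebraMap E F)).natDegree = 3 := by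
    rw [natDegree_map, minpoly.natDegree_eq_three hA hx]
  have hmin : minpoly F (ρ x) = (minpoly E x).map (algebraMap E F) := by
    refine (eq_of_monic_of_dvd_of_natDegree_le (minpoly.monic (.of_finite F _)) hmonic
      (minpoly.dvd F _ ?_) ?_).symm
    · rw [aeval_map_algebraMap, aeval_algHom_apply, minpoly.aeval, map_zero]
    · have hli := (linearIndependent_pow (K := E) x).map_of_isCentral (F := F) ρ
      rw [hdeg]
      by_contra! hlt
      have h0 := minpoly.aeval F (ρ x)
      rw [aeval_eq_sum_range' hlt, ← Fin.sum_univ_eq_sum_range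
        (fun i => (minpoly F (ρ x)).coeff i • ρ x ^ i)] at h0
      have h1 : ∀ i : Fin 3, (minpoly F (ρ x)).coeff i = 0 := by
        have hli' : LinearIndependent F fun i : Fin 3 => ρ x ^ (i : ℕ) := by
          have e := minpoly.natDegree_eq_three hA hx
          have := hli.comp (Fin.cast e.symm) (Fin.cast_injective _)
          simpa [Function.comp_def] using this
        exact Fintype.linearIndependent_iff.mp hli' _ h0
      refine minpoly.ne_zero (.of_finite F (ρ x)) (Polynomial.ext fun i => ?_)
      by_cases hi : i < 3
      · exact h1 ⟨i, hi⟩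
      · exact coeff_eq_zero_of_natDegree_lt (hlt.trans_le (not_lt.mp hi))
  rw [← hmin]
  refine (eq_of_monic_of_dvd_of_natDegree_le (minpoly.monic (.of_finite F _))
    (Matrix.charpoly_monic _) (Matrix.minpoly_dvd_charpoly _) ?_)
  rw [hmin, hdeg, Matrix.charpoly_natDegree_eq_dim, Fintype.card_fin]

end DegreeThree

/-! ### Irreducible cubic factors of `X ^ n - e` -/

section CubicFactor

open Polynomial

/-- If an automorphism of order three moves an `n`-th root of unity, then `3 ∣ φ n`: it acts on
the roots of unity through an element of order three of `(ZMod m)ˣ` with `m ∣ n`. -/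
theorem three_dvd_totient_of_algEquiv {E L : Type*} [Field E] [Field L] [Algebra E L]
    {σ : L ≃ₐ[E] L} (hσ : σ ^ 3 = 1) {n : ℕ} (hn : 0 < n) {ζ : L} (hζ : ζ ^ n = 1)
    (hne : σ ζ ≠ ζ) : 3 ∣ n.totient := by
  have hpos : 0 < orderOf ζ := orderOf_pos_iff.mpr (isOfFinOrder_iff_pow_eq_one.mpr ⟨n, hn, hζ⟩)
  have : NeZero (orderOf ζ) := ⟨hpos.ne'⟩
  have hprim : IsPrimitiveRoot ζ (orderOf ζ) := .orderOf ζ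
  refine dvd_trans ?_ (Nat.totient_dvd_of_dvd (orderOf_dvd_of_pow_eq_one hζ))
  have hord : orderOf (hprim.autToPow E σ) = 3 := by
    refine orderOf_eq_prime (by rw [← map_pow, hσ, map_one]) fun h1 => hne ?_
    have hs := hprim.autToPow_spec E σ
    rw [h1, ← map_one (hprim.autToPow E), hprim.autToPow_spec E 1] at hs
    exact hs.symm
  rw [← hord, ← ZMod.card_units_eq_totient]
  exact orderOf_dvd_card

/-- An irreducible cubic factor of `X ^ n - e` is a pure cubic, unless `3 ∣ φ n`. -/
theorem Polynomial.three_dvd_totient_or_eq_X_pow_three_sub {E : Type*} [Field E] [CharZero E]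
    {p : E[X]} (hp : Irreducible p) (hmonic : p.Monic) (hdeg : p.natDegree = 3) {n : ℕ}
    (hn : 0 < n) {e : E} (hdvd : p ∣ X ^ n - C e) :
    3 ∣ n.totient ∨ ∃ c : E, p = X ^ 3 - C c := by
  classical
  have hprime : Fact (Nat.Prime 3) := ⟨Nat.prime_three⟩
  -- an element of order three in the Galois group
  obtain ⟨σ, hσ⟩ : ∃ σ : p.Gal, orderOf σ = 3 :=
    exists_prime_orderOf_dvd_card' 3
      (hdeg ▸ Gal.prime_degree_dvd_card hp (hdeg ▸ Nat.prime_three))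
  let L := p.SplittingField
  let s : L ≃ₐ[E] L := σ
  have hs3 : s ^ 3 = 1 := by
    have := pow_orderOf_eq_one σ
    rwa [hσ] at this
  have hs3' : ∀ x, s (s (s x)) = x := fun x => by
    have := DFunLike.congr_fun hs3 x
    simpa [pow_succ] using this
  -- it moves some root
  obtain ⟨α, hα, hsα⟩ : ∃ α ∈ p.rootSet L, s α ≠ α := by
    by_contra! h
    have h1 : σ = 1 := Gal.ext p fun x hx => h x hx
    rw [h1, orderOf_one] at hσ
    omega
  have hαp : aeval α p = 0 := (mem_rootSet.mp hα).2
  have hpow : α ^ n = algebraMap E L e := by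
    obtain ⟨q, hq⟩ := hdvd
    have := congrArg (aeval α) hq
    rw [map_mul, hαp, zero_mul] at this
    simpa [sub_eq_zero] using this
  have hα0 : α ≠ 0 := by
    rintro rfl
    exact hsα (map_zero s)
  have hζ : (s α / α) ^ n = 1 := by
    rw [div_pow, ← map_pow, hpow, AlgEquiv.commutes, div_self]
    rw [← hpow]
    exact pow_ne_zero n hα0
  by_cases hfix : s (s α / α) = s α / α
  · right
    set ζ := s α / α with hζdef
    have h1 : s α = ζ * α := by rw [hζdef, div_mul_cancel₀ _ hα0]
    have h2 : s (s α) = ζ ^ 2 * α := by rw [h1, map_mul, hfix, h1]; ring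
    have h3 : ζ ^ 3 = 1 := by
      have := hs3' α
      rw [h2, map_mul, map_pow, hfix, h1] at this
      apply mul_right_cancel₀ hα0
      linear_combination this
    -- the polynomial has the roots `α`, `s α = ζ * α` and `s (s α) = ζ ^ 2 * α`, with the same cube
    have hroot : ∀ x, aeval x p = 0 → aeval (s x) p = 0 := fun x hx => by
      rw [aeval_algEquiv, AlgHom.comp_apply, hx]; simp
    have hfac : p.map (algebraMap E L) = X ^ 3 - C (α ^ 3) := by
      have hc : (({α, s α, s (s α)} : Finset L)).card = 3 := by
        refine Finset.card_eq_three.mpr ⟨α, s α, s (s α), hsα.symm, ?_, ?_, rfl⟩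
        · intro h
          exact hsα (by conv_lhs => rw [h, hs3'])
        · exact fun h => hsα (s.injective h).symm
      refine eq_of_degree_sub_lt_of_eval_finset_eq {α, s α, s (s α)} ?_ ?_
      · rw [hc]
        have hd : (p.map (algebraMap E L)).degree = 3 := by
          rw [degree_map, degree_eq_natDegree hp.ne_zero, hdeg]; rfl
        refine (degree_sub_lt_left ?_ ?_ ?_).trans_eq hd
        · rw [hd, degree_X_pow_sub_C (by norm_num)]; rfl
        · exact (hmonic.map _).ne_zero
        · rw [(hmonic.map _).leadingCoeff, (monic_X_pow_sub_C _ (by norm_num)).leadingCoeff]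
      · intro x hx
        have hcube : x ^ 3 = α ^ 3 ∧ aeval x p = 0 := by
          simp only [Finset.mem_insert, Finset.mem_singleton] at hx
          rcases hx with rfl | rfl | rfl
          · exact ⟨rfl, hαp⟩
          · exact ⟨by rw [h1, mul_pow, h3, one_mul], hroot _ hαp⟩
          · exact ⟨by rw [h2, mul_pow, ← pow_mul, mul_comm 2, pow_mul, h3]; simp,
              hroot _ (hroot _ hαp)⟩
        rw [eval_map_algebraMap, hcube.2]
        simp [hcube.1]
    refine ⟨-p.coeff 0, ?_⟩
    apply Polynomial.map_injective (algebraMap E L) (algebraMap E L).injective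
    have h0 : algebraMap E L (p.coeff 0) = - α ^ 3 := by
      rw [← coeff_map, hfac, coeff_sub, coeff_C_zero, coeff_X_pow]; simp
    rw [hfac]
    simp [h0, sub_eq_add_neg]
  · exact Or.inl (three_dvd_totient_of_algEquiv hs3 hn hζ hfix)

end CubicFactor

section ProjectiveOrder

open Polynomial Module

/-- The order `n` of a noncentral element modulo scalars in a division algebra of degree three. -/
theorem three_dvd_totient_or_dvd_three_of_pow_eq_smul_one {E F A : Type*} [Field E] [CharZero E]
    [Field F] [Algebra E F] [DivisionRing A] [Algebra E A] [Algebra.IsCentral E A]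
    (hA : finrank E A = 9) (ρ : A →ₐ[E] Matrix (Fin 3) (Fin 3) F) {a : A}
    (ha : a ∉ Set.range (algebraMap E A)) {n : ℕ} (hn : 0 < n)
    (hscalar : ∃ μ : F, ρ a ^ n = μ • 1)
    (hmin : ∀ m : ℕ, (∃ μ : F, ρ a ^ m = μ • 1) → n ∣ m) :
    3 ∣ n.totient ∨ n ∣ 3 := by
  have : FiniteDimensional E A := .of_finrank_pos (by omega)
  have hint : IsIntegral E a := .of_finite E a
  obtain ⟨μ, hμ⟩ := hscalar
  obtain ⟨e, he⟩ := Algebra.IsCentral.exists_eq_algebraMap_of_forall_commute (E := E) (x := a ^ n)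
    fun y => by
      apply ρ.toRingHom.injective
      simp [hμ]
  refine (Polynomial.three_dvd_totient_or_eq_X_pow_three_sub (minpoly.irreducible hint)
    (minpoly.monic hint) (minpoly.natDegree_eq_three hA ha) hn (e := e)
    (minpoly.dvd E a (by simp [he]))).imp_right ?_
  rintro ⟨c, hc⟩
  refine hmin 3 ⟨algebraMap E F c, ?_⟩
  have h3 := minpoly.aeval E a
  rw [hc] at h3
  have h3' : a ^ 3 = algebraMap E A c := by simpa [sub_eq_zero] using h3
  rw [← map_pow, h3', AlgHom.commutes, algebraMap_smul, Algebra.algebraMap_eq_smul_one]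

end ProjectiveOrder

/-! ### Isotropic vectors and the action on the complex hyperbolic plane -/

section Hyperbolic

theorem SU21.smul_eq_mulVec (g : SU21) (z : Fin 3 → ℂ) :
    g • z = ((g : Matrix.SpecialLinearGroup (Fin 3) ℂ) : Matrix (Fin 3) (Fin 3) ℂ) *ᵥ z := rfl

theorem mk_mem_complexHyperbolicPlane {w : Fin 3 → ℂ} (hw : w ≠ 0) (hneg : stdNorm w < 0) :
    Projectivization.mk ℂ w hw ∈ complexHyperbolicPlane := by
  intro z hz hz0
  rw [Projectivization.submodule_mk, Submodule.mem_span_singleton] at hz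
  obtain ⟨c, rfl⟩ := hz
  have hc : c ≠ 0 := by
    rintro rfl
    simp at hz0
  have : stdNorm (c • w) = ‖c‖ ^ 2 * stdNorm w := by
    simp only [stdNorm, Pi.smul_apply, smul_eq_mul, norm_mul]
    ring
  rw [this]
  have := norm_pos_iff.mpr hc
  exact mul_neg_of_pos_of_neg (by positivity) hneg

/-- Four eigenvectors in general position force a matrix to be scalar. -/
theorem eq_smul_one_of_eigenvectors {K : Type*} [Field K] {Z : Matrix (Fin 3) (Fin 3) K}
    (b : Module.Basis (Fin 3) K (Fin 3 → K)) {c d : Fin 3 → K} (hc : ∀ i, c i ≠ 0)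
    (hb : ∀ i, Z *ᵥ b i = d i • b i) {μ : K} (hsum : Z *ᵥ (∑ i, c i • b i) = μ • ∑ i, c i • b i) :
    Z = μ • 1 := by
  have h1 : ∑ i, (c i * (d i - μ)) • b i = 0 := by
    rw [Matrix.mulVec_sum, Finset.smul_sum, ← sub_eq_zero, ← Finset.sum_sub_distrib] at hsum
    rw [← hsum]
    refine Finset.sum_congr rfl fun i _ => ?_
    rw [Matrix.mulVec_smul, hb]
    module
  have h2 : ∀ i, d i = μ := fun i => sub_eq_zero.mp <|
    (mul_eq_zero.mp (Fintype.linearIndependent_iff.mp b.linearIndependent _ h1 i)).resolve_left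
      (hc i)
  apply Matrix.toLin'.injective
  refine b.ext fun i => ?_
  simp [hb, h2]

/-- A matrix having every vector `(x, y, 1)` with `|x|² + |y|² = s`, `s > 0`, as an eigenvector is
scalar. -/
theorem exists_eq_smul_one_of_forall_eigenvector {Z : Matrix (Fin 3) (Fin 3) ℂ} {s : ℝ}
    (hs : 0 < s) (hZ : ∀ w : Fin 3 → ℂ, w 2 = 1 → ‖w 0‖ ^ 2 + ‖w 1‖ ^ 2 = s ^ 2 →
      ∃ μ : ℂ, Z *ᵥ w = μ • w) : ∃ μ : ℂ, Z = μ • 1 := by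
  have hsC : (s : ℂ) ≠ 0 := by exact_mod_cast hs.ne'
  let w : Fin 3 → Fin 3 → ℂ := ![![(s : ℂ), 0, 1], ![-(s : ℂ), 0, 1], ![0, (s : ℂ), 1]]
  have hli : LinearIndependent ℂ w := by
    have : IsUnit (Matrix.of w).det := by
      rw [isUnit_iff_ne_zero, Matrix.det_fin_three]
      simp [w, hs.ne']
    exact Matrix.linearIndependent_rows_iff_isUnit.mpr
      ((Matrix.isUnit_iff_isUnit_det _).mpr this)
  let b := basisOfLinearIndependentOfCardEqFinrank hli (by simp)
  have hbw : ∀ i, b i = w i := fun i => by simp [b]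
  have hd : ∀ i, ∃ d : ℂ, Z *ᵥ b i = d • b i := fun i => by
    rw [hbw]
    apply hZ <;> fin_cases i <;> simp [w]
  choose d hd using hd
  let c : Fin 3 → ℂ := ![1, 1, -1]
  have hcw : ∑ i, c i • b i = ![0, -(s : ℂ), 1] := by
    simp_rw [Fin.sum_univ_three, hbw]
    ext i
    fin_cases i <;> simp [w, c]
  obtain ⟨μ, hμ⟩ := hZ ![0, -(s : ℂ), 1] (by simp) (by simp)
  exact ⟨μ, eq_smul_one_of_eigenvectors b (c := c) (by intro i; fin_cases i <;> simp [c]) hd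
    (by rw [hcw]; exact hμ)⟩

theorem SU21.coe_pow (g : SU21) (m : ℕ) :
    (((g ^ m : SU21) : Matrix.SpecialLinearGroup (Fin 3) ℂ) : Matrix (Fin 3) (Fin 3) ℂ) =
      ((g : Matrix.SpecialLinearGroup (Fin 3) ℂ) : Matrix (Fin 3) (Fin 3) ℂ) ^ m := by
  simp

theorem actionOrder_dvd_iff (g : SU21) (m : ℕ) :
    actionOrder g ∣ m ↔ ∀ x : complexHyperbolicPlane, g ^ m • x = x := by
  rw [actionOrder, orderOf_dvd_iff_pow_eq_one, ← map_pow, Equiv.ext_iff]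
  rfl

/-- An element of `SU(2,1)` acts trivially on the complex hyperbolic plane iff it is scalar. -/
theorem actionOrder_dvd_iff_exists_pow_eq_smul_one (g : SU21) (m : ℕ) :
    actionOrder g ∣ m ↔ ∃ μ : ℂ,
      ((g : Matrix.SpecialLinearGroup (Fin 3) ℂ) : Matrix (Fin 3) (Fin 3) ℂ) ^ m = μ • 1 := by
  rw [actionOrder_dvd_iff, ← SU21.coe_pow]
  constructor
  · intro h
    refine exists_eq_smul_one_of_forall_eigenvector (s := 1 / 2) (by norm_num) fun w hw2 hw => ?_
    have hw0 : w ≠ 0 := by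
      rintro rfl
      simp at hw2
    have hneg : stdNorm w < 0 := by
      rw [stdNorm, hw, hw2]
      norm_num
    have h1 := congrArg Subtype.val (h ⟨_, mk_mem_complexHyperbolicPlane hw0 hneg⟩)
    have h2 : Projectivization.mk ℂ (g ^ m • w) ((smul_ne_zero_iff_ne _).mpr hw0) =
      Projectivization.mk ℂ w hw0 := h1
    obtain ⟨a, ha⟩ := (Projectivization.mk_eq_mk_iff ℂ _ _ _ _).mp h2
    exact ⟨a, ha.symm⟩
  · rintro ⟨μ, hμ⟩ ⟨x, hx⟩
    apply Subtype.ext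
    change g ^ m • x = x
    induction x using Projectivization.ind with
    | h w hw =>
      refine (Projectivization.mk_eq_mk_iff' ℂ (g ^ m • w) w
        ((smul_ne_zero_iff_ne _).mpr hw) hw).mpr ⟨μ, ?_⟩
      rw [SU21.smul_eq_mulVec, hμ, Matrix.smul_mulVec, Matrix.one_mulVec]

/-- The infinitesimal unipotent transformation `w ↦ i ⟨v, w⟩ v` attached to a vector `v`. -/
noncomputable def isotropicNilpotent (v : Fin 3 → ℂ) : Matrix (Fin 3) (Fin 3) ℂ :=
  Complex.I • Matrix.vecMulVec v (star v ᵥ* stdForm)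

theorem isotropicNilpotent_mulVec (v w : Fin 3 → ℂ) :
    isotropicNilpotent v *ᵥ w = (Complex.I * (star v ⬝ᵥ (stdForm *ᵥ w))) • v := by
  rw [isotropicNilpotent, Matrix.smul_mulVec, Matrix.vecMulVec_mulVec, Matrix.dotProduct_mulVec,
    mul_smul, op_smul_eq_smul]

theorem isotropicNilpotent_mul_self {v : Fin 3 → ℂ} (hv : stdNorm v = 0) :
    isotropicNilpotent v * isotropicNilpotent v = 0 := by
  have h0 : star v ⬝ᵥ (stdForm *ᵥ v) = 0 := by rw [← stdNorm_eq, hv, Complex.ofReal_zero]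
  apply Matrix.toLin'.injective
  refine LinearMap.ext fun w => ?_
  simp [isotropicNilpotent_mulVec, h0]

theorem stdForm_conjTranspose : stdFormᴴ = stdForm := by
  ext i j
  fin_cases i <;> fin_cases j <;> simp [stdForm, Matrix.conjTranspose_apply, Matrix.diagonal]

theorem isotropicNilpotent_skew (v : Fin 3 → ℂ) :
    (isotropicNilpotent v)ᴴ * stdForm + stdForm * isotropicNilpotent v = 0 := by
  rw [isotropicNilpotent, Matrix.conjTranspose_smul, Matrix.conjTranspose_vecMulVec,
    Matrix.star_vecMul, star_star, stdForm_conjTranspose, Matrix.smul_mul, Matrix.mul_smul,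
    Matrix.vecMulVec_mul, Matrix.mul_vecMulVec]
  simp

/-- A matrix commuting with all the transformations `isotropicNilpotent v` is scalar, because every
isotropic vector is an eigenvector of it. -/
theorem exists_eq_smul_one_of_commute_isotropicNilpotent {Z : Matrix (Fin 3) (Fin 3) ℂ}
    (hZ : ∀ v : Fin 3 → ℂ, stdNorm v = 0 →
      Z * isotropicNilpotent v = isotropicNilpotent v * Z) : ∃ μ : ℂ, Z = μ • 1 := by
  refine exists_eq_smul_one_of_forall_eigenvector (s := 1) one_pos fun v hv2 hv => ?_
  have hiso : stdNorm v = 0 := by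
    rw [stdNorm, hv, hv2]
    simp
  -- apply the commutation relation to a vector that is not orthogonal to `v`
  have h1 := congrArg (fun X : Matrix (Fin 3) (Fin 3) ℂ => X *ᵥ ![0, 0, Complex.I]) (hZ v hiso)
  have h2 : star v ⬝ᵥ (stdForm *ᵥ ![0, 0, Complex.I]) = -Complex.I := by
    simp [stdForm, dotProduct, Fin.sum_univ_three, Matrix.mulVec_diagonal, hv2]
  simp only [← Matrix.mulVec_mulVec, isotropicNilpotent_mulVec, Matrix.mulVec_smul, h2] at h1
  rw [mul_neg, Complex.I_mul_I, neg_neg, one_smul] at h1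
  exact ⟨_, h1⟩

end Hyperbolic

/-! ### The lattice of an order in the product of its completions -/

section Lattice

open Module Topology MeasureTheory

/-- Minkowski's theorem for `ℤ ^ K` and the preimage of a cube under a unimodular linear map. -/
theorem exists_int_ne_zero_norm_le_two {K : Type*} [Fintype K] [Nonempty K]
    (f : (K → ℝ) →ₗ[ℝ] (K → ℝ)) (hf : LinearMap.det f = 1) :
    ∃ c : K → ℤ, c ≠ 0 ∧ ‖f (fun k => (c k : ℝ))‖ ≤ 2 := by
  classical
  let b := Pi.basisFun ℝ K
  have hvol : volume (ZSpan.fundamentalDomain b) * 2 ^ finrank ℝ (K → ℝ) <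
      volume (f ⁻¹' Metric.closedBall 0 2) := by
    rw [Measure.addHaar_preimage_linearMap _ (by simp [hf]), hf, ZSpan.fundamentalDomain_pi_basisFun,
      Real.volume_pi_closedBall _ (by norm_num), volume_pi_pi, finrank_fintype_fun_eq_card]
    simp only [Real.volume_Ico, sub_zero, ENNReal.ofReal_one, Finset.prod_const_one, one_mul,
      inv_one, abs_one]
    rw [ENNReal.ofReal_pow (by norm_num), show (2 * 2 : ℝ) = ((4 : ℕ) : ℝ) by norm_num,
      ENNReal.ofReal_natCast]
    have : 2 ^ Fintype.card K < 4 ^ Fintype.card K :=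
      Nat.pow_lt_pow_left (by norm_num) Fintype.card_ne_zero
    exact_mod_cast this
  have : Countable (Submodule.span ℤ (Set.range b)).toAddSubgroup :=
    inferInstanceAs (Countable (Submodule.span ℤ (Set.range b)))
  obtain ⟨x, hx0, hx⟩ := exists_ne_zero_mem_lattice_of_measure_mul_two_pow_lt_measure
    (ZSpan.isAddFundamentalDomain' b volume) (s := f ⁻¹' Metric.closedBall 0 2)
    (fun y hy => by simpa using hy) ((convex_closedBall 0 2).is_linear_preimage f.isLinear) hvol
  obtain ⟨c, hc⟩ := (b.mem_span_iff_repr_mem ℤ _).mp x.2 |> Classical.skolem.mp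
  have hxc : (x : K → ℝ) = fun k => (c k : ℝ) := by
    ext k
    simpa [b] using (hc k).symm
  refine ⟨c, ?_, ?_⟩
  · rintro rfl
    exact hx0 (Subtype.ext (hxc.trans (by ext; simp)))
  · rw [← hxc]
    simpa using hx

theorem Pi.finite_int_of_isCompact {K : Type*} [Fintype K] {S : Set (K → ℝ)} (hS : IsCompact S) :
    {c : K → ℤ | (fun k => (c k : ℝ)) ∈ S}.Finite := by
  obtain ⟨R, hR⟩ := hS.isBounded.exists_norm_le
  refine (Set.Finite.pi fun _ : K => Set.finite_Icc (-⌈R⌉) ⌈R⌉).subset fun c hc k _ => ?_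
  have h1 : |(c k : ℝ)| ≤ R := (norm_le_pi_norm (fun k => (c k : ℝ)) k).trans (hR _ hc)
  have h2 : ((|c k| : ℤ) : ℝ) ≤ (⌈R⌉ : ℝ) := by
    rw [Int.cast_abs]
    exact h1.trans (Int.le_ceil R)
  exact abs_le.mp (by exact_mod_cast h2)

variable {E A : Type*} [Field E] [DivisionRing A] [Algebra E A]
  {I : Type*}

/-- The diagonal map from the division algebra to the product of matrix algebras given by a family
of matrix representations. -/
def diagonalEmbedding (ρ : I → A →+* Matrix (Fin 3) (Fin 3) ℂ) :
    A →+* (I → Matrix (Fin 3) (Fin 3) ℂ) := RingHom.pi ρ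

theorem linearIndependent_map_of_isMatrixEmbedding [Algebra.IsCentral E A] {σ : E →+* ℂ}
    {ρ : A →+* Matrix (Fin 3) (Fin 3) ℂ} (hρ : IsMatrixEmbedding σ ρ) {ι : Type*} {a : ι → A}
    (ha : LinearIndependent E a) : LinearIndependent ℂ (fun i => ρ (a i)) := by
  let _ : Algebra E ℂ := σ.toAlgebra
  let ρ' : A →ₐ[E] Matrix (Fin 3) (Fin 3) ℂ := { ρ with commutes' := hρ }
  exact ha.map_of_isCentral ρ'

theorem NumberField.eq_zero_of_sum_mul_embedding_eq_zero [NumberField E]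
    {σ : I → E →+* ℂ}
    (hσ : ∀ φ : E →+* ℂ, ∃ i, φ = σ i ∨ φ = ComplexEmbedding.conjugate (σ i))
    {t : Free.ChooseBasisIndex ℤ (𝓞 E) → ℝ}
    (ht : ∀ i, ∑ j, (t j : ℂ) * σ i (integralBasis E j) = 0) : t = 0 := by
  have hall : ∀ φ : E →+* ℂ, ∑ j, (t j : ℂ) * φ (integralBasis E j) = 0 := by
    intro φ
    obtain ⟨i, rfl | rfl⟩ := hσ φ
    · exact ht i
    · have := congrArg (starRingEnd ℂ) (ht i)
      simpa using this
  have h1 : ∑ j, (t j : ℂ) • canonicalEmbedding.latticeBasis E j = 0 := by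
    ext φ
    simpa [canonicalEmbedding.apply_at] using hall φ
  funext j
  exact_mod_cast Fintype.linearIndependent_iff.mp
    (canonicalEmbedding.latticeBasis E).linearIndependent _ h1 j

theorem IsROrder.exists_basis [Algebra.IsCentral E A] (hA : finrank E A = 9)
    {O : Subalgebra (𝓞 E) A} (hO : IsROrder E O) :
    ∃ a : Basis (Fin 9) E A, ∀ l, a l ∈ O := by
  have : FiniteDimensional E A := .of_finrank_pos (by omega)
  obtain ⟨s, hs, hspan, hli⟩ := exists_linearIndependent E (O : Set A)
  rw [hO.2] at hspan
  let b : Basis s E A := Basis.mk hli (by simp [hspan])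
  have : Fintype s := FiniteDimensional.fintypeBasisIndex b
  let e : s ≃ Fin 9 := Fintype.equivFinOfCardEq (by rw [← finrank_eq_card_basis b, hA])
  refine ⟨b.reindex e, fun l => ?_⟩
  simpa [b] using hs (e.symm l).2

/-- A full lattice inside an order, as the integral points of coordinates on the product of the
matrix algebras at one half of the complex embeddings. -/
theorem IsROrder.exists_coordinates [NumberField E] [Fintype I] [Algebra.IsCentral E A] (hA : finrank E A = 9)
    {O : Subalgebra (𝓞 E) A} (hO : IsROrder E O) {σ : I → E →+* ℂ}
    (hσ : ∀ φ : E →+* ℂ, ∃ i, φ = σ i ∨ φ = ComplexEmbedding.conjugate (σ i))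
    (hcard : 2 * Fintype.card I = finrank ℚ E) {ρ : I → A →+* Matrix (Fin 3) (Fin 3) ℂ}
    (hρ : ∀ i, IsMatrixEmbedding (σ i) (ρ i)) :
    ∃ (e : Free.ChooseBasisIndex ℤ (𝓞 E) × Fin 9 → A)
      (Φ : (Free.ChooseBasisIndex ℤ (𝓞 E) × Fin 9 → ℝ) ≃L[ℝ] (I → Matrix (Fin 3) (Fin 3) ℂ)),
      (∀ k, e k ∈ O) ∧
      (∀ x : A, ∃ m : ℤ, m ≠ 0 ∧
        ∃ c : Free.ChooseBasisIndex ℤ (𝓞 E) × Fin 9 → ℤ, m • x = ∑ k, c k • e k) ∧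
      ∀ c : Free.ChooseBasisIndex ℤ (𝓞 E) × Fin 9 → ℤ,
        Φ (fun k => (c k : ℝ)) = diagonalEmbedding ρ (∑ k, c k • e k) := by
  obtain ⟨a, ha⟩ := hO.exists_basis hA
  let ω := integralBasis E
  let e : Free.ChooseBasisIndex ℤ (𝓞 E) × Fin 9 → A := fun k => ω k.1 • a k.2
  let f : (Free.ChooseBasisIndex ℤ (𝓞 E) × Fin 9 → ℝ) →ₗ[ℝ] (I → Matrix (Fin 3) (Fin 3) ℂ) :=
    Fintype.linearCombination ℝ fun k => diagonalEmbedding ρ (e k)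
  have hf : ∀ t, f t = ∑ k, t k • diagonalEmbedding ρ (e k) :=
    fun t => Fintype.linearCombination_apply ℝ _ t
  have hinj : Function.Injective f := by
    rw [injective_iff_map_eq_zero]
    intro t ht
    rw [hf] at ht
    have h1 : ∀ i l, ∑ j, (t (j, l) : ℂ) * σ i (ω j) = 0 := by
      intro i
      refine Fintype.linearIndependent_iff.mp
        (linearIndependent_map_of_isMatrixEmbedding (hρ i) a.linearIndependent) _ ?_
      have h2 := congrFun ht i
      rw [Fintype.sum_prod_type_right, Finset.sum_apply] at h2
      refine Eq.trans (Finset.sum_congr rfl fun l _ => ?_) h2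
      rw [Finset.sum_apply, Finset.sum_smul]
      refine Finset.sum_congr rfl fun j _ => ?_
      have h3 : diagonalEmbedding ρ (e (j, l)) i = σ i (ω j) • ρ i (a l) := by
        change ρ i (ω j • a l) = _
        rw [Algebra.smul_def, map_mul, hρ i, Matrix.scalar_apply,
          ← Matrix.smul_eq_diagonal_mul]
      rw [Pi.smul_apply, h3, mul_smul, Complex.coe_smul]
    funext ⟨j, l⟩
    exact congrFun (NumberField.eq_zero_of_sum_mul_embedding_eq_zero hσ
      (t := fun j => t (j, l)) (fun i => h1 i l)) j
  have hdim : finrank ℝ (Free.ChooseBasisIndex ℤ (𝓞 E) × Fin 9 → ℝ) =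
      finrank ℝ (I → Matrix (Fin 3) (Fin 3) ℂ) := by
    rw [finrank_fintype_fun_eq_card, Fintype.card_prod, ← finrank_eq_card_basis ω, ← hcard,
      finrank_pi_fintype]
    simp only [Module.finrank_matrix, Fintype.card_fin, Complex.finrank_real_complex,
      Finset.sum_const, Finset.card_univ, smul_eq_mul]
    ring
  refine ⟨e, (LinearEquiv.ofInjectiveOfFinrankEq f hinj hdim).toContinuousLinearEquiv, ?_, ?_, ?_⟩
  · intro k
    have : e k = RingOfIntegers.basis E k.1 • a k.2 := by
      simp only [e, ω, integralBasis_apply]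
      rw [algebraMap_smul]
    rw [this]
    exact O.smul_mem (ha _) _
  · intro x
    obtain ⟨⟨m, hm⟩, hm'⟩ := IsLocalization.exist_integer_multiples_of_finite (nonZeroDivisors ℤ)
      (fun k : Free.ChooseBasisIndex ℤ (𝓞 E) × Fin 9 => ω.repr (a.repr x k.2) k.1)
    choose c hc using hm'
    refine ⟨m, nonZeroDivisors.ne_zero hm, c, ?_⟩
    conv_lhs => rw [← a.sum_repr x, Finset.smul_sum]
    rw [Fintype.sum_prod_type_right]
    refine Finset.sum_congr rfl fun l _ => ?_
    conv_lhs => rw [← ω.sum_repr (a.repr x l), Finset.sum_smul, Finset.smul_sum]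
    refine Finset.sum_congr rfl fun j _ => ?_
    have h4 : (c (j, l) : ℚ) = m * ω.repr (a.repr x l) j := by simpa using hc (j, l)
    have h5 : (c (j, l)) • ω j = m • (ω.repr (a.repr x l) j • ω j) := by
      rw [← Int.cast_smul_eq_zsmul ℚ, h4, mul_smul, Int.cast_smul_eq_zsmul]
    simp only [e]
    rw [← smul_assoc, ← h5, smul_assoc]
  · intro c
    change f _ = _
    rw [hf, map_sum]
    refine Finset.sum_congr rfl fun k _ => ?_
    rw [map_zsmul, Int.cast_smul_eq_zsmul]

end Lattice

/-! ### Cocompactness of the special unitary group of an order -/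

section Cocompactness

open Module Topology Polynomial

theorem Set.Infinite.exists_infinite_fiber {α β : Type*} {T : Set α} (hT : T.Infinite)
    {F : Set β} (hF : F.Finite) {f : α → β} (hf : ∀ t ∈ T, f t ∈ F) :
    ∃ b, {t ∈ T | f t = b}.Infinite := by
  by_contra! h
  refine hT ((hF.biUnion fun b _ => h b).subset fun t ht => ?_)
  exact Set.mem_biUnion (hf t ht) ⟨ht, rfl⟩

variable {E A : Type*} [Field E] [DivisionRing A] [Algebra E A]

theorem IsROrder.isIntegral [NumberField E] {O : Subalgebra (𝓞 E) A} (hO : IsROrder E O) {x : A}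
    (hx : x ∈ O) : IsIntegral ℤ x := by
  have : Module.Finite (𝓞 E) O := .of_fg hO.1
  have : Module.Finite ℤ O := Module.Finite.trans (𝓞 E) O
  exact (IsIntegral.of_finite ℤ (⟨x, hx⟩ : O)).map (O.val.toRingHom.toIntAlgHom)

/-- The reduced characteristic polynomial of an integral element: a monic cubic polynomial over the
center with integral coefficients, independent of the representation. -/
theorem exists_reduced_charpoly [Algebra.IsCentral E A] (hA : finrank E A = 9) {x : A} (hx : IsIntegral ℤ x) :
    ∃ f : E[X], f.Monic ∧ f.natDegree = 3 ∧ aeval x f = 0 ∧ (∀ j, IsIntegral ℤ (f.coeff j)) ∧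
      ∀ (σ : E →+* ℂ) (ρ : A →+* Matrix (Fin 3) (Fin 3) ℂ), IsMatrixEmbedding σ ρ →
        (ρ x).charpoly = f.map σ := by
  obtain ⟨p, hp, hpx⟩ := hx
  have hdvd : minpoly E x ∣ p.map (algebraMap ℤ E) := by
    refine minpoly.dvd E x ?_
    rw [aeval_def, eval₂_map, RingHom.ext_int ((algebraMap E A).comp (algebraMap ℤ E))
      (algebraMap ℤ A), hpx]
  by_cases hxE : x ∈ Set.range (algebraMap E A)
  · obtain ⟨e, rfl⟩ := hxE
    have hmin : minpoly E (algebraMap E A e) = X - C e := minpoly.eq_X_sub_C A e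
    rw [hmin] at hdvd
    refine ⟨(X - C e) ^ 3, (monic_X_sub_C e).pow 3, by simp, by simp,
      isIntegral_coeff_of_dvd (p ^ 3) _ (hp.pow 3) ((monic_X_sub_C e).pow 3) ?_, ?_⟩
    · rw [Polynomial.map_pow]
      exact pow_dvd_pow_of_dvd hdvd 3
    · intro σ ρ hρ
      rw [hρ e, Matrix.scalar_apply, Matrix.charpoly_diagonal]
      simp
  · have : FiniteDimensional E A := .of_finrank_pos (by omega)
    have hmonic : (minpoly E x).Monic := minpoly.monic (.of_finite E x)
    refine ⟨minpoly E x, hmonic, minpoly.natDegree_eq_three hA hxE, minpoly.aeval E x,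
      isIntegral_coeff_of_dvd p _ hp hmonic hdvd, fun σ ρ hρ => ?_⟩
    let _ : Algebra E ℂ := σ.toAlgebra
    let ρ' : A →ₐ[E] Matrix (Fin 3) (Fin 3) ℂ := { ρ with commutes' := hρ }
    exact charpoly_map_eq_minpoly_map hA ρ' hxE

/-- The reduced norm of an element `x` of an order, and an element `y` of the order (the adjugate of
`x`) such that `x * y` is the reduced norm. -/
theorem IsROrder.exists_reduced_norm [NumberField E] [Algebra.IsCentral E A] (hA : finrank E A = 9)
    {O : Subalgebra (𝓞 E) A} (hO : IsROrder E O) {x : A} (hx : x ∈ O) :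
    ∃ ν : E, IsIntegral ℤ ν ∧
      (∀ (σ : E →+* ℂ) (ρ : A →+* Matrix (Fin 3) (Fin 3) ℂ), IsMatrixEmbedding σ ρ →
        (ρ x).det = σ ν) ∧
      ∃ y ∈ O, x * y = algebraMap E A ν := by
  obtain ⟨f, hf, hdeg, hfx, hint, hchar⟩ := exists_reduced_charpoly hA (hO.isIntegral hx)
  refine ⟨-f.coeff 0, (hint 0).neg, ?_, x ^ 2 + algebraMap E A (f.coeff 2) * x +
    algebraMap E A (f.coeff 1), ?_, ?_⟩
  · intro σ ρ hρ
    rw [Matrix.det_eq_sign_charpoly_coeff, hchar σ ρ hρ, coeff_map, map_neg, Fintype.card_fin]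
    ring
  · have hmem : ∀ j, algebraMap E A (f.coeff j) ∈ O := fun j =>
      O.algebraMap_mem ⟨f.coeff j, hint j⟩
    exact add_mem (add_mem (pow_mem hx 2) (mul_mem (hmem 2) hx)) (hmem 1)
  · rw [aeval_eq_sum_range, hdeg, Finset.sum_range_succ, Finset.sum_range_succ,
      Finset.sum_range_succ, Finset.sum_range_one, ← hdeg, hf.coeff_natDegree, hdeg] at hfx
    simp only [Algebra.smul_def, map_one, pow_zero, pow_one, mul_one, one_mul] at hfx
    rw [map_neg, ← add_eq_zero_iff_eq_neg, ← hfx, mul_add, mul_add, ← mul_assoc x _ x,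
      ← Algebra.commutes (f.coeff 2) x, ← Algebra.commutes (f.coeff 1) x]
    noncomm_ring

variable {I : Type*}

theorem exists_isCompact_forall_exists_int {K : Type*} [Fintype K] [Nonempty K]
    (Φ : (K → ℝ) ≃L[ℝ] (I → Matrix (Fin 3) (Fin 3) ℂ)) :
    ∃ 𝒦 : Set (I → Matrix (Fin 3) (Fin 3) ℂ), IsCompact 𝒦 ∧
      ∀ g : I → Matrix (Fin 3) (Fin 3) ℂ, LinearMap.det (LinearMap.mulLeft ℝ g) = 1 →
        ∃ c : K → ℤ, c ≠ 0 ∧ g * Φ (fun k => (c k : ℝ)) ∈ 𝒦 := by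
  refine ⟨Φ '' Metric.closedBall 0 2, (isCompact_closedBall 0 2).image Φ.continuous, ?_⟩
  intro g hg
  obtain ⟨c, hc0, hc⟩ := exists_int_ne_zero_norm_le_two
    (Φ.symm.toLinearEquiv.toLinearMap ∘ₗ LinearMap.mulLeft ℝ g ∘ₗ
      Φ.symm.toLinearEquiv.symm.toLinearMap)
    (by rw [LinearMap.det_conj, hg])
  refine ⟨c, hc0, _, mem_closedBall_zero_iff.mpr hc, ?_⟩
  simp

theorem exists_int_ne_zero_forall_smul_mem {K ι : Type*} [Fintype K] [Finite ι] {e : K → A}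
    (hden : ∀ x : A, ∃ m : ℤ, m ≠ 0 ∧ ∃ c : K → ℤ, m • x = ∑ k, c k • e k) (a : ι → A) :
    ∃ m : ℤ, m ≠ 0 ∧ ∀ i, m • a i ∈ Submodule.span ℤ (Set.range e) := by
  classical
  cases nonempty_fintype ι
  choose m hm0 c hc using fun i => hden (a i)
  refine ⟨∏ i, m i, Finset.prod_ne_zero_iff.mpr fun i _ => hm0 i, fun i => ?_⟩
  rw [← Finset.prod_erase_mul _ _ (Finset.mem_univ i), mul_smul, hc]
  exact Submodule.smul_mem _ _ (Submodule.sum_mem _ fun k _ =>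
    Submodule.smul_mem _ _ (Submodule.subset_span ⟨k, rfl⟩))

/-- If `g` preserves the Hermitian forms `B * ρ h`, then the value `star x * h * x` depends only
on `g * x` at each place; so it takes finitely many values when `g * x` stays in a compact set. -/
theorem finite_star_mul_mul_of_isCompact [CharZero A] [StarRing A] {K : Type*} [Fintype K] {e : K → A}
    (hden : ∀ x : A, ∃ m : ℤ, m ≠ 0 ∧ ∃ c : K → ℤ, m • x = ∑ k, c k • e k)
    {ρ : I → A →+* Matrix (Fin 3) (Fin 3) ℂ}
    (Φ : (K → ℝ) ≃L[ℝ] (I → Matrix (Fin 3) (Fin 3) ℂ))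
    (hΦ : ∀ c : K → ℤ, Φ (fun k => (c k : ℝ)) = diagonalEmbedding ρ (∑ k, c k • e k))
    {B : I → Matrix (Fin 3) (Fin 3) ℂ} (hB : ∀ i, IsAdjointForm (ρ i) (B i)) (h : A)
    {𝒦 : Set (I → Matrix (Fin 3) (Fin 3) ℂ)} (h𝒦 : IsCompact 𝒦) :
    {q : A | ∃ (c : K → ℤ) (g : I → Matrix (Fin 3) (Fin 3) ℂ),
      (∀ i, (g i)ᴴ * (B i * ρ i h) * g i = B i * ρ i h) ∧ g * Φ (fun k => (c k : ℝ)) ∈ 𝒦 ∧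
      star (∑ k, c k • e k) * h * (∑ k, c k • e k) = q}.Finite := by
  obtain ⟨m, hm0, hm⟩ := exists_int_ne_zero_forall_smul_mem hden
    (fun p : K × K => star (e p.1) * h * e p.2)
  let Ψ : (I → Matrix (Fin 3) (Fin 3) ℂ) → I → Matrix (Fin 3) (Fin 3) ℂ := fun w i =>
    m • ((B i)⁻¹ * ((w i)ᴴ * (B i * ρ i h) * w i))
  have hΨ : Continuous Ψ := by fun_prop
  have hfin := Pi.finite_int_of_isCompact
    (Φ.toHomeomorph.isCompact_preimage.mpr (h𝒦.image hΨ))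
  refine Set.Finite.of_finite_image (f := fun q => m • q)
    ((hfin.image fun d => ∑ k, d k • e k).subset ?_) fun q _ q' _ hq => ?_
  · rintro _ ⟨_, ⟨c, g, hg, hc, rfl⟩, rfl⟩
    set x := ∑ k, c k • e k with hx
    have hmem : m • (star x * h * x) ∈ Submodule.span ℤ (Set.range e) := by
      have h1 : m • (star x * h * x) = ∑ k, ∑ l, (c k * c l) • (m • (star (e k) * h * e l)) := by
        rw [hx, star_sum, Finset.sum_mul, Finset.sum_mul_sum, Finset.smul_sum]
        refine Finset.sum_congr rfl fun k _ => ?_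
        rw [Finset.smul_sum]
        refine Finset.sum_congr rfl fun l _ => ?_
        rw [star_zsmul, smul_mul_assoc, smul_mul_assoc, mul_smul_comm, smul_smul, smul_smul,
          smul_smul]
        congr 1
        ring
      rw [h1]
      exact Submodule.sum_mem _ fun k _ => Submodule.sum_mem _ fun l _ =>
        Submodule.smul_mem _ _ (hm (k, l))
    obtain ⟨d, hd⟩ := (Submodule.mem_span_range_iff_exists_fun ℤ).mp hmem
    refine ⟨d, ?_, hd⟩
    refine ⟨_, hc, ?_⟩
    change Ψ _ = Φ _
    rw [hΦ, hΦ d, hd, ← hx]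
    funext i
    have h2 : (ρ i x)ᴴ * (B i * ρ i h) * ρ i x = B i * ρ i (star x * h * x) := by
      rw [← Matrix.mul_assoc, ← (hB i).2.2, map_mul, map_mul]
      simp only [Matrix.mul_assoc]
    change m • ((B i)⁻¹ * ((g i * ρ i x)ᴴ * (B i * ρ i h) * (g i * ρ i x))) =
      ρ i (m • (star x * h * x))
    have h3 : (g i * ρ i x)ᴴ * (B i * ρ i h) * (g i * ρ i x) =
        (ρ i x)ᴴ * ((g i)ᴴ * (B i * ρ i h) * g i) * ρ i x := by
      rw [Matrix.conjTranspose_mul]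
      simp only [Matrix.mul_assoc]
    rw [h3, hg, h2, Matrix.nonsing_inv_mul_cancel_left _ _ (hB i).2.1, map_zsmul]
  · exact smul_right_injective A hm0 hq

/-- A pigeonhole form of cocompactness. Minkowski's theorem gives, for each transformation `g t`, a
nonzero lattice point `x` with `g t * x` in a fixed compact set. Then the reduced norm of `x`, the
element `star x * h * x` and the class of `x` modulo a multiple of the norm take finitely many
values, and two points with the same values differ by an element of the group. -/
theorem IsROrder.exists_infinite_translates_mem_isCompact [NumberField E] [Fintype I]
    [Algebra.IsCentral E A] [StarRing A] (hA : finrank E A = 9) {O : Subalgebra (𝓞 E) A}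
    (hO : IsROrder E O) {σ : I → E →+* ℂ}
    (hσ : ∀ φ : E →+* ℂ, ∃ i, φ = σ i ∨ φ = ComplexEmbedding.conjugate (σ i))
    (hcard : 2 * Fintype.card I = finrank ℚ E) {ρ : I → A →+* Matrix (Fin 3) (Fin 3) ℂ}
    (hρ : ∀ i, IsMatrixEmbedding (σ i) (ρ i)) {B : I → Matrix (Fin 3) (Fin 3) ℂ}
    (hB : ∀ i, IsAdjointForm (ρ i) (B i)) (h : A)
    {g : ℕ → I → Matrix (Fin 3) (Fin 3) ℂ}
    (hg : ∀ t i, (g t i)ᴴ * (B i * ρ i h) * g t i = B i * ρ i h)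
    (hdet : ∀ t i, (g t i).det = 1) (hmul : ∀ t, LinearMap.det (LinearMap.mulLeft ℝ (g t)) = 1)
    (i₀ : I) :
    ∃ T : Set ℕ, T.Infinite ∧ ∃ 𝒦 : Set (I → Matrix (Fin 3) (Fin 3) ℂ), IsCompact 𝒦 ∧
      ∀ t ∈ T, ∃ w ∈ SUO (ρ i₀) h O hO, g t * diagonalEmbedding ρ w ∈ 𝒦 := by
  have : CharZero A := charZero_of_injective_algebraMap (algebraMap E A).injective
  obtain ⟨e, Φ, heO, hden, hΦ⟩ := hO.exists_coordinates hA hσ hcard hρ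
  have hLO : ∀ c : _ → ℤ, ∑ k, c k • e k ∈ O := fun c =>
    sum_mem fun k _ => zsmul_mem (heO k) (c k)
  obtain ⟨𝒦, h𝒦, hmink⟩ := exists_isCompact_forall_exists_int Φ
  choose c hc0 hc using fun t => hmink (g t) (hmul t)
  let x : ℕ → A := fun t => ∑ k, c t k • e k
  have hxO : ∀ t, x t ∈ O := fun t => hLO (c t)
  have hgx : ∀ t, g t * diagonalEmbedding ρ (x t) ∈ 𝒦 := fun t => by
    rw [← hΦ]; exact hc t
  have hx0 : ∀ t, x t ≠ 0 := by
    intro t h0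
    have h1 := hΦ (c t)
    rw [show ∑ k, c t k • e k = 0 from h0, map_zero, map_eq_zero_iff Φ Φ.injective] at h1
    exact hc0 t (funext fun k => by simpa using congrFun h1 k)
  choose ν hνint hν y hyO hy using fun t => hO.exists_reduced_norm hA (hxO t)
  have hν0 : ∀ t, ν t ≠ 0 := by
    intro t h0
    have h1 : y t = 0 := by
      have := hy t
      rw [h0, map_zero] at this
      exact (mul_eq_zero.mp this).resolve_left (hx0 t)
    have h2 := hν t _ _ (hρ i₀)
    rw [h0, map_zero] at h2
    have h3 : (ρ i₀ (x t)).det * (ρ i₀ (x t)⁻¹).det = 1 := by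
      rw [← Matrix.det_mul, ← map_mul, mul_inv_cancel₀ (hx0 t), map_one, Matrix.det_one]
    rw [h2, zero_mul] at h3
    exact zero_ne_one h3
  -- finitely many reduced norms
  obtain ⟨F₁, hF₁, hνF⟩ : ∃ F : Set E, F.Finite ∧ ∀ t, ν t ∈ F := by
    have hcont : Continuous fun w : I → Matrix (Fin 3) (Fin 3) ℂ => ∑ i, ‖(w i).det‖ := by
      fun_prop
    obtain ⟨C, hC⟩ := (h𝒦.image hcont).bddAbove
    refine ⟨_, Embeddings.finite_of_norm_le E ℂ C, fun t => ⟨hνint t, fun φ => ?_⟩⟩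
    have h1 : ∀ i, ‖σ i (ν t)‖ ≤ C := by
      intro i
      have h2 := hC ⟨_, hgx t, rfl⟩
      refine le_trans ?_ h2
      have h3 : ‖σ i (ν t)‖ = ‖((g t * diagonalEmbedding ρ (x t)) i).det‖ := by
        rw [← hν t _ _ (hρ i), Pi.mul_apply, Matrix.det_mul, hdet, one_mul]
        rfl
      rw [h3]
      exact Finset.single_le_sum
        (f := fun i => ‖((g t * diagonalEmbedding ρ (x t)) i).det‖)
        (fun i _ => norm_nonneg _) (Finset.mem_univ i)
    obtain ⟨i, rfl | rfl⟩ := hσ φ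
    · exact h1 i
    · simpa using h1 i
  -- finitely many values of the Hermitian form
  obtain ⟨F₂, hF₂, hqF⟩ : ∃ F : Set A, F.Finite ∧ ∀ t, star (x t) * h * x t ∈ F :=
    ⟨_, finite_star_mul_mul_of_isCompact hden Φ hΦ hB h h𝒦, fun t =>
      ⟨c t, g t, hg t, hc t, rfl⟩⟩
  obtain ⟨⟨ν₀, q₀⟩, hT₁⟩ := Set.infinite_univ.exists_infinite_fiber (hF₁.prod hF₂)
    (f := fun t => (ν t, star (x t) * h * x t)) fun t _ => ⟨hνF t, hqF t⟩
  -- a rational integer `m` divisible by the common reduced norm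
  obtain ⟨m, hm0, d, hd⟩ := hden (algebraMap E A ν₀⁻¹)
  have : NeZero m.natAbs := ⟨Int.natAbs_ne_zero.mpr hm0⟩
  obtain ⟨r₀, hT⟩ := hT₁.exists_infinite_fiber Set.finite_univ
    (f := fun t k => (c t k : ZMod m.natAbs)) fun t _ => Set.mem_univ _
  obtain ⟨s, hs⟩ := hT.nonempty
  refine ⟨_, hT, (fun w => w * diagonalEmbedding ρ (x s)⁻¹) '' 𝒦,
    h𝒦.image (continuous_id.mul continuous_const), fun t ht => ?_⟩
  obtain ⟨⟨-, hs1⟩, hs2⟩ := hs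
  obtain ⟨⟨-, ht1⟩, ht2⟩ := ht
  obtain ⟨hsν, hsq⟩ := Prod.mk.inj hs1
  obtain ⟨htν, htq⟩ := Prod.mk.inj ht1
  let w : Aˣ := Units.mk0 (x t * (x s)⁻¹) (mul_ne_zero (hx0 t) (inv_ne_zero (hx0 s)))
  have hwx : (w : A) * x s = x t := by simp [w, hx0 s]
  refine ⟨w, ⟨⟨?_, ?_⟩, ?_⟩, ?_⟩
  · have h1 : star (w * x s) * h * (w * x s) = star (x s) * h * x s := by
      rw [hwx, htq, hsq]
    apply mul_left_cancel₀ (star_ne_zero.mpr (hx0 s))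
    apply mul_right_cancel₀ (hx0 s)
    simpa only [star_mul, mul_assoc] using h1
  · have h1 := hν t _ _ (hρ i₀)
    rw [← hwx, map_mul, Matrix.det_mul, hν s _ _ (hρ i₀), htν, hsν] at h1
    exact mul_right_cancel₀ ((map_ne_zero (σ i₀)).mpr (hsν ▸ hν0 s)) (h1.trans (one_mul _).symm)
  · -- `w = 1 + (x t - x s) * (x s)⁻¹`, where `x t - x s` is divisible by `m` and `m * (x s)⁻¹`
    -- lies in the order
    have hcong : ∀ k, ∃ u : ℤ, c t k - c s k = m * u := fun k => by
      have h1 := congrFun (ht2.trans hs2.symm) k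
      obtain ⟨u, hu⟩ := Int.natAbs_dvd.mp
        ((ZMod.intCast_eq_intCast_iff_dvd_sub _ _ _).mp h1.symm)
      exact ⟨u, hu⟩
    choose u hu using hcong
    have h2 : x t = x s + m • ∑ k, u k • e k := by
      simp only [x]
      rw [Finset.smul_sum, ← Finset.sum_add_distrib]
      refine Finset.sum_congr rfl fun k _ => ?_
      rw [smul_smul, ← hu, sub_smul, add_sub_cancel]
    have h3 : m • (x s)⁻¹ ∈ O := by
      have h4 : x s * (y s * (m • algebraMap E A ν₀⁻¹)) = m • (1 : A) := by
        rw [← mul_assoc, hy, hsν, mul_smul_comm, ← map_mul, mul_inv_cancel₀ (hsν ▸ hν0 s),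
          map_one]
      have h5 : m • (x s)⁻¹ = y s * (m • algebraMap E A ν₀⁻¹) := by
        apply mul_left_cancel₀ (hx0 s)
        rw [h4, mul_smul_comm, mul_inv_cancel₀ (hx0 s)]
      rw [h5, hd]
      exact mul_mem (hyO s) (hLO d)
    have h6 : (w : A) = 1 + (∑ k, u k • e k) * (m • (x s)⁻¹) := by
      simp only [w, Units.val_mk0]
      rw [h2, add_mul, mul_inv_cancel₀ (hx0 s), mul_smul_comm, smul_mul_assoc]
    rw [h6]
    exact add_mem (one_mem O) (mul_mem (hLO u) h3)
  · refine ⟨_, hgx t, ?_⟩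
    simp only [w, Units.val_mk0]
    rw [map_mul, mul_assoc]

end Cocompactness

/-! ### Subgroups of finite index generate the division algebra -/

section Density

open Module Topology Polynomial

theorem LinearMap.det_mulLeft_one_add_of_mul_self_eq_zero {k R : Type*} [Field k] [Ring R]
    [Algebra k R] [FiniteDimensional k R] {N : R} (hN : N * N = 0) :
    LinearMap.det (LinearMap.mulLeft k (1 + N)) = 1 := by
  have hnil : IsNilpotent (LinearMap.mulLeft k (-N)) := by
    refine ⟨2, ?_⟩
    ext x
    simp [pow_two, ← mul_assoc, hN]
  have h1 := LinearMap.eval_charpoly (LinearMap.mulLeft k (-N)) (1 : k)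
  rw [hnil.charpoly_eq_X_pow_finrank, eval_pow, eval_X, one_pow] at h1
  rw [h1]
  congr 1
  ext x
  simp [add_mul]

/-- A matrix polynomial in `t` that takes values in a compact set for infinitely many natural
numbers `t` is constant. -/
theorem eq_zero_of_infinite_add_smul_mem_isCompact {n : Type*} {U V W : Matrix n n ℂ} {T : Set ℕ}
    (hT : T.Infinite) {𝒦 : Set (Matrix n n ℂ)} (h𝒦 : IsCompact 𝒦)
    (hmem : ∀ t ∈ T, U + (t : ℂ) • V + (t : ℂ) ^ 2 • W ∈ 𝒦) : V = 0 := by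
  ext a b
  by_contra hV
  let p : ℂ[X] := C (U a b) + X * C (V a b) + X ^ 2 * C (W a b)
  have hcoeff : p.coeff 1 ≠ 0 := by
    simpa [p, coeff_C, coeff_X_pow_mul', coeff_X_mul (n := 0)] using hV
  have hdeg : 0 < p.degree := by
    by_contra! h
    exact hcoeff (coeff_eq_zero_of_degree_lt (h.trans_lt (by norm_num)))
  have htend := p.tendsto_norm_atTop hdeg (l := Filter.atTop) (z := fun t : ℕ => (t : ℂ))
    (by simpa using tendsto_natCast_atTop_atTop)
  have hcont : Continuous fun M : Matrix n n ℂ => ‖M a b‖ := by fun_prop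
  obtain ⟨C, hC⟩ := (h𝒦.image hcont).bddAbove
  obtain ⟨t₀, ht₀⟩ := Filter.eventually_atTop.mp (htend.eventually_gt_atTop C)
  obtain ⟨t, ht, hlt⟩ := hT.exists_gt t₀
  refine (ht₀ t hlt.le).not_ge (le_of_eq_of_le ?_ (hC ⟨_, hmem t ht, rfl⟩))
  simp [p, mul_comm (V a b), mul_comm (W a b)]

theorem Subgroup.exists_infinite_mul_inv_mem {G : Type*} [Group G] {Δ Γ : Subgroup G}
    (hΔ : Δ.relIndex Γ ≠ 0) {T : Set ℕ} (hT : T.Infinite) {w : ℕ → G} (hw : ∀ t ∈ T, w t ∈ Γ) :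
    ∃ s ∈ T, {t ∈ T | w t * (w s)⁻¹ ∈ Δ}.Infinite := by
  have : (Δ.subgroupOf Γ).FiniteIndex := ⟨hΔ⟩
  have : Infinite T := hT.to_subtype
  obtain ⟨q, hq⟩ := Finite.exists_infinite_fiber
    (fun t : T => (((⟨w t, hw t t.2⟩ : Γ)⁻¹ : Γ) : Γ ⧸ Δ.subgroupOf Γ))
  have hinf := Set.infinite_coe_iff.mp hq
  obtain ⟨s, hs⟩ := hinf.nonempty
  refine ⟨s, s.2, (hinf.image Subtype.val_injective.injOn).mono ?_⟩
  rintro _ ⟨t, ht, rfl⟩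
  refine ⟨t.2, ?_⟩
  have h1 := QuotientGroup.eq.mp (Eq.trans ht (Eq.symm hs))
  simpa [Subgroup.mem_subgroupOf] using h1

variable {E A : Type*} [Field E] [NumberField E] [DivisionRing A] [Algebra E A]
  [Algebra.IsCentral E A] [StarRing A] {I : Type*} [Fintype I]

/-- An element of the algebra that commutes with a subgroup of finite index of `SU(h, O)` commutes
with all the unipotent one-parameter subgroups of the ambient real group: the conjugates of `z`
under such a subgroup are polynomial in the parameter, and they are bounded by cocompactness. -/
theorem IsROrder.commute_nilpotent_of_forall_commute (hA : finrank E A = 9)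
    {O : Subalgebra (𝓞 E) A}
    (hO : IsROrder E O) {σ : I → E →+* ℂ}
    (hσ : ∀ φ : E →+* ℂ, ∃ i, φ = σ i ∨ φ = ComplexEmbedding.conjugate (σ i))
    (hcard : 2 * Fintype.card I = finrank ℚ E) {ρ : I → A →+* Matrix (Fin 3) (Fin 3) ℂ}
    (hρ : ∀ i, IsMatrixEmbedding (σ i) (ρ i)) {B : I → Matrix (Fin 3) (Fin 3) ℂ}
    (hB : ∀ i, IsAdjointForm (ρ i) (B i)) {h : A} {i₀ : I} {Δ : Subgroup Aˣ}
    (hΔ : Δ.relIndex (SUO (ρ i₀) h O hO) ≠ 0) {z : A}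
    (hz : ∀ w ∈ Δ, (w : A) * z = z * w) {Y : Matrix (Fin 3) (Fin 3) ℂ} (hY : Y * Y = 0)
    (hskew : Yᴴ * (B i₀ * ρ i₀ h) + B i₀ * ρ i₀ h * Y = 0) :
    ρ i₀ z * Y = Y * ρ i₀ z := by
  classical
  set H := B i₀ * ρ i₀ h with hH
  let N : I → Matrix (Fin 3) (Fin 3) ℂ := Pi.single i₀ Y
  have hN : N * N = 0 := by
    rw [← Pi.single_mul, hY, Pi.single_zero]
  let g : ℕ → I → Matrix (Fin 3) (Fin 3) ℂ := fun t => 1 + (t : ℂ) • N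
  have hg₀ : ∀ t, g t i₀ = 1 + (t : ℂ) • Y := fun t => by simp [g, N]
  have hg₁ : ∀ t i, i ≠ i₀ → g t i = 1 := fun t i hi => by simp [g, N, hi]
  have hYY : Yᴴ * (H * Y) = 0 := by
    have h1 : H * Y = - (Yᴴ * H) := eq_neg_of_add_eq_zero_right hskew
    rw [h1, Matrix.mul_neg, ← Matrix.mul_assoc, ← Matrix.conjTranspose_mul, hY,
      Matrix.conjTranspose_zero, Matrix.zero_mul, neg_zero]
  have hform : ∀ t i, (g t i)ᴴ * (B i * ρ i h) * g t i = B i * ρ i h := by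
    intro t i
    by_cases hi : i = i₀
    · subst hi
      rw [hg₀, ← hH, Matrix.conjTranspose_add, Matrix.conjTranspose_one,
        Matrix.conjTranspose_smul, star_natCast]
      have h1 : (1 + (t : ℂ) • Yᴴ) * H * (1 + (t : ℂ) • Y) =
          H + (t : ℂ) • (Yᴴ * H + H * Y) + (t : ℂ) ^ 2 • (Yᴴ * (H * Y)) := by
        simp only [add_mul, mul_add, Matrix.smul_mul, Matrix.mul_smul, one_mul, mul_one, smul_add,
          Matrix.mul_assoc]
        module
      rw [h1, hskew, hYY, smul_zero, smul_zero, add_zero, add_zero]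
    · rw [hg₁ t i hi]
      simp
  have hinv : ∀ t : ℂ, (1 + t • Y) * (1 - t • Y) = 1 := by
    intro t
    simp [add_mul, mul_sub, hY]
  have hdetY : ∀ t : ℂ, (1 + t • Y).det = 1 := by
    intro t
    have hnil : IsNilpotent (-(t • Y)) := ⟨2, by simp [pow_two, hY]⟩
    have h1 := Matrix.eval_charpoly (-(t • Y)) 1
    have h2 := (Matrix.isNilpotent_charpoly_sub_pow_of_isNilpotent hnil).eq_zero
    rw [sub_eq_zero.mp h2] at h1
    simpa using h1.symm
  obtain ⟨T, hT, 𝒦, h𝒦, hw⟩ := hO.exists_infinite_translates_mem_isCompact hA hσ hcard hρ hB h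
    hform
    (by
      intro t i
      by_cases hi : i = i₀
      · subst hi
        rw [hg₀, hdetY]
      · rw [hg₁ t i hi, Matrix.det_one])
    (fun t => by
      refine LinearMap.det_mulLeft_one_add_of_mul_self_eq_zero ?_
      rw [smul_mul_smul_comm, hN, smul_zero])
    i₀
  choose! w hwmem hw using hw
  -- pass to a coset of the subgroup of finite index
  obtain ⟨s, hsT, hT'⟩ := Subgroup.exists_infinite_mul_inv_mem hΔ hT hwmem
  have hVzero := eq_zero_of_infinite_add_smul_mem_isCompact (U := ρ i₀ z)
    (V := Y * ρ i₀ z - ρ i₀ z * Y) (W := -(Y * ρ i₀ z * Y)) hT'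
    ((h𝒦.image (f := fun x : I → Matrix (Fin 3) (Fin 3) ℂ =>
      x i₀ * ρ i₀ ((w s)⁻¹ : Aˣ)) (by fun_prop)).image
      (f := fun M : Matrix (Fin 3) (Fin 3) ℂ => M * ρ i₀ z * M.adjugate) (by fun_prop)) ?_
  · exact (sub_eq_zero.mp hVzero).symm
  rintro t ⟨htT, htΔ⟩
  set γ := w t * (w s)⁻¹
  refine ⟨_, ⟨_, hw t htT, rfl⟩, ?_⟩
  have hM : (g t * diagonalEmbedding ρ (w t)) i₀ * ρ i₀ ((w s)⁻¹ : Aˣ) =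
      (1 + (t : ℂ) • Y) * ρ i₀ γ := by
    rw [Pi.mul_apply, hg₀, Units.val_mul, map_mul, ← Matrix.mul_assoc]
    rfl
  have hdetγ : (ρ i₀ γ).det = 1 :=
    ((SUO (ρ i₀) h O hO).mul_mem (hwmem t htT) (inv_mem (hwmem s hsT))).1.2
  have hadj : ((1 + (t : ℂ) • Y) * ρ i₀ γ).adjugate = ρ i₀ (γ⁻¹ : Aˣ) * (1 - (t : ℂ) • Y) := by
    have h1 : ((1 + (t : ℂ) • Y) * ρ i₀ γ).det = 1 := by
      rw [Matrix.det_mul, hdetY, hdetγ, one_mul]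
    have h2 : ((1 + (t : ℂ) • Y) * ρ i₀ γ) * (ρ i₀ (γ⁻¹ : Aˣ) * (1 - (t : ℂ) • Y)) = 1 := by
      rw [Matrix.mul_assoc, ← Matrix.mul_assoc (ρ i₀ γ), ← map_mul, Units.mul_inv, map_one,
        Matrix.one_mul, hinv]
    rw [← Matrix.inv_eq_right_inv h2, Matrix.inv_def, h1]
    simp
  have hzγ : ρ i₀ γ * ρ i₀ z * ρ i₀ (γ⁻¹ : Aˣ) = ρ i₀ z := by
    rw [← map_mul, ← map_mul, hz γ htΔ, Units.mul_inv_cancel_right]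
  beta_reduce
  rw [hM, hadj]
  calc (1 + (t : ℂ) • Y) * ρ i₀ γ * ρ i₀ z * (ρ i₀ (γ⁻¹ : Aˣ) * (1 - (t : ℂ) • Y))
      = (1 + (t : ℂ) • Y) * (ρ i₀ γ * ρ i₀ z * ρ i₀ (γ⁻¹ : Aˣ)) * (1 - (t : ℂ) • Y) := by
        simp only [Matrix.mul_assoc]
    _ = _ := by
        rw [hzγ]
        simp only [add_mul, mul_sub, Matrix.smul_mul, Matrix.mul_smul, one_mul, mul_one]
        module

end Density

/-! ### Elements commensurating the special unitary group of an order -/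

section Commensurator

open Module

/-- For a CM field, a choice of one embedding in each conjugate pair, equal to `ι` at the place of
`ι`, together with the given representation at `ι` and representations obtained from the signature
hypothesis at the other places. -/
theorem exists_adjointForm_family {E A : Type*} [Field E] [NumberField E] [IsCMField E]
    [DivisionRing A] [Algebra E A] [StarRing A] {ι : E →+* ℂ} {h : A} {p q : ℕ}
    (hsig : ∀ σ : E →+* ℂ, σ.comp (algebraMap (maximalRealSubfield E) E) ≠
      ι.comp (algebraMap (maximalRealSubfield E) E) → HasSignatureAt σ h p q)
    {ρ : A →+* Matrix (Fin 3) (Fin 3) ℂ} {B : Matrix (Fin 3) (Fin 3) ℂ}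
    (hρ : IsMatrixEmbedding ι ρ) (hB : IsAdjointForm ρ B) :
    ∃ (σ : InfinitePlace E → E →+* ℂ)
      (ρ' : InfinitePlace E → A →+* Matrix (Fin 3) (Fin 3) ℂ)
      (B' : InfinitePlace E → Matrix (Fin 3) (Fin 3) ℂ),
      (∀ v, InfinitePlace.mk (σ v) = v) ∧ (∀ v, IsMatrixEmbedding (σ v) (ρ' v)) ∧
      (∀ v, IsAdjointForm (ρ' v) (B' v)) ∧
      ρ' (InfinitePlace.mk ι) = ρ ∧ B' (InfinitePlace.mk ι) = B := by
  have hex : ∀ v : InfinitePlace E, ∃ (σ : E →+* ℂ) (ρ' : A →+* Matrix (Fin 3) (Fin 3) ℂ)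
      (B' : Matrix (Fin 3) (Fin 3) ℂ), InfinitePlace.mk σ = v ∧ IsMatrixEmbedding σ ρ' ∧
      IsAdjointForm ρ' B' ∧ (v = InfinitePlace.mk ι → ρ' = ρ ∧ B' = B) := by
    intro v
    by_cases hv : v = InfinitePlace.mk ι
    · exact ⟨ι, ρ, B, hv.symm, hρ, hB, fun _ => ⟨rfl, rfl⟩⟩
    · obtain ⟨ρ', B', hρ', hB', -⟩ := hsig v.embedding fun heq => hv <| by
        apply (IsCMField.equivInfinitePlace E).injective
        rw [IsCMField.equivInfinitePlace_apply, IsCMField.equivInfinitePlace_apply,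
          InfinitePlace.comap_mk, ← heq, ← InfinitePlace.comap_mk, InfinitePlace.mk_embedding]
      exact ⟨v.embedding, ρ', B', InfinitePlace.mk_embedding v, hρ', hB', fun h => absurd h hv⟩
  choose σ ρ' B' h1 h2 h3 h4 using hex
  exact ⟨σ, ρ', B', h1, h2, h3, (h4 _ rfl).1, (h4 _ rfl).2⟩

/-- A subgroup of finite index of `SU(h, O)` generates the division algebra. -/
theorem IsROrder.adjoin_eq_top_of_relIndex_ne_zero {E A : Type*} [Field E] [NumberField E]
    [IsCMField E] [DivisionRing A] [Algebra E A] [Algebra.IsCentral E A] [StarRing A]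
    (hA : finrank E A = 9) {O : Subalgebra (𝓞 E) A} (hO : IsROrder E O) {ι : E →+* ℂ} {h : A}
    {p q : ℕ}
    (hsig : ∀ σ : E →+* ℂ, σ.comp (algebraMap (maximalRealSubfield E) E) ≠
      ι.comp (algebraMap (maximalRealSubfield E) E) → HasSignatureAt σ h p q)
    {ρ : A →+* Matrix (Fin 3) (Fin 3) ℂ} {B : Matrix (Fin 3) (Fin 3) ℂ} {P : GL (Fin 3) ℂ}
    (hρ : IsMatrixEmbedding ι ρ) (hB : IsAdjointForm ρ B)
    (hP : (P : Matrix (Fin 3) (Fin 3) ℂ)ᴴ * stdForm * P = B * ρ h)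
    {Δ : Subgroup Aˣ} (hΔ : Δ.relIndex (SUO ρ h O hO) ≠ 0) :
    Algebra.adjoin E ((fun w : Aˣ => (w : A)) '' (Δ ⊓ SUO ρ h O hO : Subgroup Aˣ)) = ⊤ := by
  obtain ⟨σ, ρ', B', hσ, hρ', hB', rfl, rfl⟩ := exists_adjointForm_family hsig hρ hB
  refine Algebra.adjoin_eq_top_of_centralizer hA fun z hz => ?_
  have hcover : ∀ φ : E →+* ℂ, ∃ i, φ = σ i ∨ φ = ComplexEmbedding.conjugate (σ i) := by
    intro φ
    refine ⟨InfinitePlace.mk φ, ?_⟩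
    exact (InfinitePlace.mk_eq_iff.mp (hσ (InfinitePlace.mk φ))).imp Eq.symm Eq.symm
  have hcard : 2 * Fintype.card (InfinitePlace E) = finrank ℚ E := by
    rw [InfinitePlace.card_eq_nrRealPlaces_add_nrComplexPlaces,
      IsTotallyComplex.nrRealPlaces_eq_zero, zero_add, IsTotallyComplex.finrank]
  set i₀ := InfinitePlace.mk ι
  have hPi : (P : Matrix (Fin 3) (Fin 3) ℂ) * ((P⁻¹ : GL (Fin 3) ℂ) : Matrix _ _ ℂ) = 1 :=
    P.mul_inv
  have hPi' : ((P⁻¹ : GL (Fin 3) ℂ) : Matrix (Fin 3) (Fin 3) ℂ) * P = 1 := P.inv_mul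
  set Q := ((P⁻¹ : GL (Fin 3) ℂ) : Matrix (Fin 3) (Fin 3) ℂ)
  set R := (P : Matrix (Fin 3) (Fin 3) ℂ)
  have hcomm : ∀ v : Fin 3 → ℂ, stdNorm v = 0 →
      ρ' i₀ z * (Q * isotropicNilpotent v * R) = (Q * isotropicNilpotent v * R) * ρ' i₀ z := by
    intro v hv
    refine hO.commute_nilpotent_of_forall_commute hA hcover hcard hρ' hB'
      (Δ := Δ ⊓ SUO (ρ' i₀) h O hO) (by rwa [Subgroup.inf_relIndex_right])
      (fun w hw => hz _ ⟨w, hw, rfl⟩) ?_ ?_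
    · calc Q * isotropicNilpotent v * R * (Q * isotropicNilpotent v * R)
          = Q * isotropicNilpotent v * (R * Q) * isotropicNilpotent v * R := by
            simp only [Matrix.mul_assoc]
        _ = Q * (isotropicNilpotent v * isotropicNilpotent v) * R := by
            rw [hPi, Matrix.mul_one]
            simp only [Matrix.mul_assoc]
        _ = 0 := by rw [isotropicNilpotent_mul_self hv, Matrix.mul_zero, Matrix.zero_mul]
    · have hPs := congrArg Matrix.conjTranspose hPi
      rw [Matrix.conjTranspose_mul, Matrix.conjTranspose_one] at hPs
      rw [← hP, Matrix.conjTranspose_mul, Matrix.conjTranspose_mul]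
      calc Rᴴ * ((isotropicNilpotent v)ᴴ * Qᴴ) * (Rᴴ * stdForm * R) +
            Rᴴ * stdForm * R * (Q * isotropicNilpotent v * R)
          = Rᴴ * (isotropicNilpotent v)ᴴ * (Qᴴ * Rᴴ) * stdForm * R +
            Rᴴ * stdForm * (R * Q) * isotropicNilpotent v * R := by
            simp only [Matrix.mul_assoc]
        _ = Rᴴ * ((isotropicNilpotent v)ᴴ * stdForm + stdForm * isotropicNilpotent v) * R := by
            rw [hPi, hPs, Matrix.mul_one, Matrix.mul_one, Matrix.mul_add, Matrix.add_mul]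
            simp only [Matrix.mul_assoc]
        _ = 0 := by rw [isotropicNilpotent_skew, Matrix.mul_zero, Matrix.zero_mul]
  obtain ⟨μ, hμ⟩ : ∃ μ : ℂ, R * ρ' i₀ z * Q = μ • 1 := by
    refine exists_eq_smul_one_of_commute_isotropicNilpotent fun v hv => ?_
    have h1 := congrArg (fun X => R * X * Q) (hcomm v hv)
    calc R * ρ' i₀ z * Q * isotropicNilpotent v
        = R * (ρ' i₀ z * (Q * isotropicNilpotent v * R)) * Q := by
          simp only [Matrix.mul_assoc, hPi, Matrix.mul_one]
      _ = R * (Q * isotropicNilpotent v * R * ρ' i₀ z) * Q := h1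
      _ = (R * Q) * isotropicNilpotent v * (R * ρ' i₀ z * Q) := by simp only [Matrix.mul_assoc]
      _ = isotropicNilpotent v * (R * ρ' i₀ z * Q) := by rw [hPi, Matrix.one_mul]
  have hz' : ρ' i₀ z = μ • 1 := by
    calc ρ' i₀ z = (Q * R) * ρ' i₀ z * (Q * R) := by rw [hPi', Matrix.one_mul, Matrix.mul_one]
      _ = Q * (R * ρ' i₀ z * Q) * R := by simp only [Matrix.mul_assoc]
      _ = μ • 1 := by
        rw [hμ, Matrix.mul_smul, Matrix.smul_mul, Matrix.mul_one, hPi']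
  obtain ⟨e, rfl⟩ := Algebra.IsCentral.exists_eq_algebraMap_of_forall_commute (E := E) (x := z)
    fun y => by
      apply (ρ' i₀).injective
      simp [hz']
  exact ⟨e, rfl⟩

/-- An element of a subgroup commensurable with `SU(h, O)` is, up to a scalar and the conjugation
by `P`, the image of an element of the division algebra. -/
theorem IsROrder.exists_semiconjBy_smul_map {E A : Type*} [Field E] [NumberField E]
    [IsCMField E] [DivisionRing A] [Algebra E A] [Algebra.IsCentral E A] [StarRing A]
    (hA : finrank E A = 9) {O : Subalgebra (𝓞 E) A} (hO : IsROrder E O) {ι : E →+* ℂ} {h : A}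
    {p q : ℕ}
    (hsig : ∀ σ : E →+* ℂ, σ.comp (algebraMap (maximalRealSubfield E) E) ≠
      ι.comp (algebraMap (maximalRealSubfield E) E) → HasSignatureAt σ h p q)
    {ρ : A →+* Matrix (Fin 3) (Fin 3) ℂ} {B : Matrix (Fin 3) (Fin 3) ℂ} {P : GL (Fin 3) ℂ}
    (hρ : IsMatrixEmbedding ι ρ) (hB : IsAdjointForm ρ B)
    (hP : (P : Matrix (Fin 3) (Fin 3) ℂ)ᴴ * stdForm * P = B * ρ h)
    {G : Subgroup (GL (Fin 3) ℂ)}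
    (hG : Subgroup.Commensurable G ((SUO ρ h O hO).map (conjEmbedding ρ P)))
    {τ : GL (Fin 3) ℂ} (hτ : τ ∈ G) :
    ∃ (a : A) (c : ℂ), a ≠ 0 ∧ c ≠ 0 ∧
      SemiconjBy (P : Matrix (Fin 3) (Fin 3) ℂ) (c • ρ a) τ := by
  let _ : Algebra E ℂ := ι.toAlgebra
  let ρ' : A →ₐ[E] Matrix (Fin 3) (Fin 3) ℂ := { ρ with commutes' := hρ }
  have : FiniteDimensional E A := .of_finrank_pos (by omega)
  let S := SUO ρ h O hO
  let f := conjEmbedding ρ P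
  let C := (MulAut.conj τ).toMonoidHom
  -- the conjugate of `SU(h, O)` by `τ` still meets `SU(h, O)` in a subgroup of finite index
  have hGC : G.map C = G := by
    ext x
    refine ⟨?_, fun hx => ⟨τ⁻¹ * x * τ, G.mul_mem (G.mul_mem (G.inv_mem hτ) hx) hτ, ?_⟩⟩
    · rintro ⟨y, hy, rfl⟩
      exact G.mul_mem (G.mul_mem hτ hy) (G.inv_mem hτ)
    · change τ * (τ⁻¹ * x * τ) * τ⁻¹ = x
      group
  have hidx : ((S.map f).map C).relIndex (S.map f) ≠ 0 := by
    refine Subgroup.relIndex_ne_zero_trans (K := G) ?_ hG.1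
    conv => enter [1, 2]; rw [← hGC]
    rw [Subgroup.relIndex_map_map_of_injective _ _ (MulAut.conj τ).injective]
    exact hG.2
  let Δ : Subgroup Aˣ := ((S.map f).map C).comap f
  have htop := hO.adjoin_eq_top_of_relIndex_ne_zero hA hsig hρ hB hP (Δ := Δ)
    (by rwa [Subgroup.relIndex_comap])
  let T : GL (Fin 3) ℂ := P⁻¹ * τ * P
  have hconj : ∀ x : A, ∃ y : A, ρ' x * (T : Matrix (Fin 3) (Fin 3) ℂ) = T * ρ' y := by
    intro x
    have hx : x ∈ Algebra.adjoin E ((fun w : Aˣ => (w : A)) '' (Δ ⊓ S : Subgroup Aˣ)) := by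
      rw [htop]; trivial
    induction hx using Algebra.adjoin_induction with
    | mem x hx =>
      obtain ⟨w, ⟨hwΔ, -⟩, rfl⟩ := hx
      obtain ⟨_, ⟨y, hy, rfl⟩, hyw⟩ := hwΔ
      refine ⟨y, ?_⟩
      have h1 : (Units.map (ρ : A →* Matrix (Fin 3) (Fin 3) ℂ) w) * T =
          T * (Units.map (ρ : A →* Matrix (Fin 3) (Fin 3) ℂ) y) := by
        have h2 : τ * (P * Units.map (ρ : A →* Matrix (Fin 3) (Fin 3) ℂ) y * P⁻¹) * τ⁻¹ =
          P * Units.map (ρ : A →* Matrix (Fin 3) (Fin 3) ℂ) w * P⁻¹ := hyw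
        have h3 : Units.map (ρ : A →* Matrix (Fin 3) (Fin 3) ℂ) w = P⁻¹ *
            (τ * (P * Units.map (ρ : A →* Matrix (Fin 3) (Fin 3) ℂ) y * P⁻¹) * τ⁻¹) * P := by
          rw [h2]; group
        rw [h3]
        simp only [T]
        group
      exact congrArg Units.val h1
    | algebraMap e =>
      refine ⟨algebraMap E A e, ?_⟩
      rw [AlgHom.commutes, Algebra.commutes]
    | add x x' _ _ hx hx' =>
      obtain ⟨y, hy⟩ := hx
      obtain ⟨y', hy'⟩ := hx'
      exact ⟨y + y', by rw [map_add, map_add, add_mul, mul_add, hy, hy']⟩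
    | mul x x' _ _ hx hx' =>
      obtain ⟨y, hy⟩ := hx
      obtain ⟨y', hy'⟩ := hx'
      exact ⟨y * y', by rw [map_mul, map_mul, mul_assoc, hy', ← mul_assoc, hy, mul_assoc]⟩
  obtain ⟨a, c, ha, hc⟩ := exists_smul_map_eq_of_conj (F := ℂ) ρ' (by rw [hA, Module.finrank_matrix]; simp)
    (T := (T : Matrix (Fin 3) (Fin 3) ℂ)) T.ne_zero hconj
  refine ⟨a, c, ha, ?_, ?_⟩
  · rintro rfl
    exact T.ne_zero (by rw [hc, zero_smul])
  · change (P : Matrix (Fin 3) (Fin 3) ℂ) * (c • ρ' a) = τ * P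
    rw [← hc, ← Units.val_mul, ← Units.val_mul]
    congr 1
    simp only [T]
    group

end Commensurator

/-! ### The order of an elliptic element -/

theorem lemma2 (Γ : Subgroup SU21) (hΓ : IsOfDivisionAlgebraType.{u, v} Γ)
    (τ : SU21) (hτ : τ ∈ Γ) (hell : IsElliptic τ)
    (n : ℕ) (hn : 2 ≤ n) (horder : actionOrder τ = n) :
    (3 ∣ Nat.totient n ∨ 3 ∣ Nat.totient (3 * n)) ∧
      (n.Prime → 3 < n → n ≡ 1 [MOD 3]) := by
  obtain ⟨E, _, _, _, ι, A, _, _, _, h, O, hO, ρ, B, P, _, hA, -, -, -, -, hsig, hρ, hB, hP,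
    hcomm⟩ := hΓ
  obtain ⟨a, c, ha0, hc0, hsemi⟩ := hO.exists_semiconjBy_smul_map hA hsig hρ hB hP hcomm
    (Subgroup.mem_map_of_mem _ hτ)
  -- a power of `τ` is scalar exactly when the same power of `a` is
  have hscalar : ∀ m : ℕ, n ∣ m ↔ ∃ μ : ℂ, ρ a ^ m = μ • 1 := by
    intro m
    rw [← horder, actionOrder_dvd_iff_exists_pow_eq_smul_one]
    have h1 := hsemi.pow_right m
    rw [smul_pow] at h1
    have h2 : (P : Matrix (Fin 3) (Fin 3) ℂ) * (c ^ m • ρ a ^ m) =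
      ((τ : Matrix.SpecialLinearGroup (Fin 3) ℂ) : Matrix (Fin 3) (Fin 3) ℂ) ^ m * P := h1
    have hcm : c ^ m ≠ 0 := pow_ne_zero m hc0
    constructor
    · rintro ⟨μ, hμ⟩
      rw [hμ, Matrix.smul_mul, Matrix.one_mul] at h2
      have h3 : c ^ m • ρ a ^ m = μ • 1 := P.isUnit.mul_left_cancel (by
        rw [h2, Matrix.mul_smul, Matrix.mul_one])
      exact ⟨(c ^ m)⁻¹ * μ, by rw [mul_smul, ← h3, inv_smul_smul₀ hcm]⟩
    · rintro ⟨μ, hμ⟩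
      refine ⟨c ^ m * μ, P.isUnit.mul_right_cancel ?_⟩
      rw [← h2, hμ, smul_smul, Matrix.mul_smul, Matrix.mul_one, Matrix.smul_mul, Matrix.one_mul]
  have hkey : 3 ∣ n.totient ∨ n ∣ 3 := by
    let _ : Algebra E ℂ := ι.toAlgebra
    let ρ' : A →ₐ[E] Matrix (Fin 3) (Fin 3) ℂ := { ρ with commutes' := hρ }
    refine three_dvd_totient_or_dvd_three_of_pow_eq_smul_one hA ρ' (a := a) ?_ (by omega)
      ((hscalar n).mp dvd_rfl) fun m => (hscalar m).mpr
    rintro ⟨e, rfl⟩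
    have h1 : n ∣ 1 := (hscalar 1).mpr ⟨ι e, by
      rw [pow_one, hρ, Matrix.scalar_apply, ← Matrix.smul_one_eq_diagonal]⟩
    have := Nat.le_of_dvd one_pos h1
    omega
  refine ⟨hkey.imp_right fun h3 => ?_, fun hp hlt => ?_⟩
  · have : n = 3 := ((Nat.dvd_prime Nat.prime_three).mp h3).resolve_left (by omega)
    subst this
    decide
  · have h3 : 3 ∣ n - 1 := by
      rw [← Nat.totient_prime hp]
      exact hkey.resolve_right fun h => absurd (Nat.le_of_dvd (by norm_num) h) (by omega)
    exact ((Nat.modEq_iff_dvd' (by omega)).mpr h3).symm
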